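/- Let $\rho,q\in C^\infty[0,\infty)$ be real functions with $\rho>0$ on $[0,\infty)$ and $\int_0^\infty\rho^{1/2}dx=\infty$; put $\tau(x)=\int_0^x\rho^{1/2}(s)\,ds$, let $x(\cdot)$ be the inverse function of $\tau$, and let $T>0$. Let $u^\delta(x,t)=:r(x,t)$ be the fundamental solution of the Neumann problem $$\rho u_{tt}-u_{xx}+qu=0\ \ (x>0),\qquad u|_{t<\tau(x)}=0,\qquad u_x|_{x=0}=\delta(t),$$ which is smooth in $\{(x,t): 0\le\tau(x)\le t\}$ and zero for $t<\tau(x)$ (the equation and the boundary condition being understood in the sense of distributions), and let $r(t):=r(0,t)$ be the response function. For a control $f\in L_2$ put $$u^f(x,t)=\int_0^{t-\tau(x)}r(x,t-s)f(s)\,ds$$ (zero for $t\le\tau(x)$). Let $\mathcal F^T=L_2(0,T)$ and $\mathcal H^T=L_2((0,x(T));\rho\,dx)$ (real spaces), and define the bounded operators - $W^T:\mathcal F^T\to\mathcal H^T$, $W^Tf=u^f(\cdot,T)$ (control operator), and $C^T=(W^T)^*W^T:\mathcal F^T\to\mathcal F^T$ (connecting operator); - $\widetilde R^{2T}:\mathcal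 F^{2T}\to\mathcal F^{2T}$, $(\widetilde R^{2T}f)(t)=u^f(0,t)=\int_0^t r(t-s)f(s)\,ds$ (extended response operator); - $J^{2T}:\mathcal F^{2T}\to\mathcal F^{2T}$, $(J^{2T}f)(t)=\int_0^t f(s)\,ds$; - $S^T:\mathcal F^T\to\mathcal F^{2T}$, $(S^Tf)(t)=f(t)$ for $0\le t\le T$ and $(S^Tf)(t)=-f(2T-t)$ for $T<t\le 2T$. Then $$C^T=\tfrac12\,(S^T)^*\,\widetilde R^{2T}J^{2T}S^T,$$ and for every $f\in\mathcal F^T$ and almost every $t\in(0,T)$ $$(C^Tf)(t)=-\int_0^T\Big[\tfrac12\int_{|t-s|}^{2T-t-s}r(\eta)\,d\eta\Big]f(s)\,ds .$$ -/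

import Mathlib

open MeasureTheory Set Filter
open scoped ContDiff

noncomputable section

namespace NeumannWave

/-- The eikonal `τ(x) = ∫₀ˣ ρ(s)^{1/2} ds`. -/
def eikonal (ρ : ℝ → ℝ) (x : ℝ) : ℝ := ∫ s in (0 : ℝ)..x, √(ρ s)

/-- The inverse function `x(·)` of the eikonal on `[0, ∞)`: the point reached by the wave front at
time `t`. -/
def frontPoint (ρ : ℝ → ℝ) (t : ℝ) : ℝ := Function.invFunOn (eikonal ρ) (Ici 0) t

/-- Standing assumptions on the density `ρ` and the potential `q`: both are smooth on `[0, ∞)`,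
`ρ` is positive there, and `∫₀^∞ ρ^{1/2} dx = ∞`. -/
structure IsAdmissible (ρ q : ℝ → ℝ) : Prop where
  smooth_density : ContDiffOn ℝ ∞ ρ (Ici 0)
  density_pos : ∀ x, 0 ≤ x → 0 < ρ x
  smooth_potential : ContDiffOn ℝ ∞ q (Ici 0)
  eikonal_tendsto : Tendsto (eikonal ρ) atTop atTop

/-- `r = u^δ` is the fundamental solution of the Neumann problem
`ρ u_tt - u_xx + q u = 0` for `x > 0`, `u = 0` for `t < τ(x)`, `u_x(0, t) = δ(t)`.
It is a function that is smooth in the closed sector `0 ≤ τ(x) ≤ t` and zero for `t < τ(x)`;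
the equation and the boundary condition hold in the sense of distributions. For a test function
`φ` with `φ_x(0, t) = 0`, two integrations by parts turn them into the last clause:
the term `-φ(0, 0)` is the pairing of the datum `u_x(0, ·) = δ` with `-φ(0, ·)`. -/
structure IsFundamentalSolution (ρ q : ℝ → ℝ) (r : ℝ → ℝ → ℝ) : Prop where
  smooth : ContDiffOn ℝ ∞ (fun p : ℝ × ℝ => r p.1 p.2)
    {p : ℝ × ℝ | 0 ≤ p.1 ∧ eikonal ρ p.1 ≤ p.2}
  eq_zero : ∀ x t : ℝ, 0 ≤ x → t < eikonal ρ x → r x t = 0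
  equation : ∀ φ : ℝ → ℝ → ℝ,
    ContDiff ℝ ∞ (fun p : ℝ × ℝ => φ p.1 p.2) →
    HasCompactSupport (fun p : ℝ × ℝ => φ p.1 p.2) →
    (∀ t : ℝ, deriv (fun x => φ x t) 0 = 0) →
    ∫ p in {p : ℝ × ℝ | 0 < p.1},
        r p.1 p.2 * (ρ p.1 * iteratedDeriv 2 (fun t => φ p.1 t) p.2
          - iteratedDeriv 2 (fun x => φ x p.2) p.1 + q p.1 * φ p.1 p.2)
      = - φ 0 0

/-- The wave `u^f(x, t) = (r(x, ·) * f)(t) = ∫₀^{t - τ(x)} r(x, t - s) f(s) ds` generated by the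
control `f` (it is zero for `t ≤ τ(x)`). -/
def wave (ρ : ℝ → ℝ) (r : ℝ → ℝ → ℝ) (f : ℝ → ℝ) (x t : ℝ) : ℝ :=
  ∫ s in Ioc 0 (t - eikonal ρ x), r x (t - s) * f s

/-- Lebesgue measure on `(0, T)`. -/
abbrev outerMeasure (T : ℝ) : Measure ℝ := volume.restrict (Ioo 0 T)

/-- The outer space `F^T = L₂(0, T)` of real controls. -/
abbrev OuterSpace (T : ℝ) : Type := Lp ℝ 2 (outerMeasure T)

/-- The measure `ρ dx` on `(0, x(T))`. -/
abbrev innerMeasure (ρ : ℝ → ℝ) (T : ℝ) : Measure ℝ :=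
  (volume.restrict (Ioo 0 (frontPoint ρ T))).withDensity (fun x => ENNReal.ofReal (ρ x))

/-- The inner space `H^T = L_{2,ρ}(0, x(T))` of real states. -/
abbrev InnerSpace (ρ : ℝ → ℝ) (T : ℝ) : Type := Lp ℝ 2 (innerMeasure ρ T)

/-- `W` is the control operator `W^T f = u^f(·, T)`. -/
def IsControlOperator (ρ : ℝ → ℝ) (r : ℝ → ℝ → ℝ) (T : ℝ)
    (W : OuterSpace T →L[ℝ] InnerSpace ρ T) : Prop :=
  ∀ f : OuterSpace T, ∀ᵐ x ∂(innerMeasure ρ T), W f x = wave ρ r f x T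

/-- `R` is the extended response operator on `L₂(0, 2T)`, `(R f)(t) = u^f(0, t)`. -/
def IsExtendedResponseOperator (ρ : ℝ → ℝ) (r : ℝ → ℝ → ℝ) (T : ℝ)
    (R : OuterSpace (2 * T) →L[ℝ] OuterSpace (2 * T)) : Prop :=
  ∀ f : OuterSpace (2 * T), ∀ᵐ t ∂(outerMeasure (2 * T)), R f t = wave ρ r f 0 t

/-- `J` is the integration operator on `L₂(0, 2T)`, `(J f)(t) = ∫₀ᵗ f(s) ds`. -/
def IsIntegrationOperator (T : ℝ)
    (J : OuterSpace (2 * T) →L[ℝ] OuterSpace (2 * T)) : Prop :=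
  ∀ f : OuterSpace (2 * T), ∀ᵐ t ∂(outerMeasure (2 * T)), J f t = ∫ s in (0 : ℝ)..t, f s

/-- `S` is the extension operator from `L₂(0, T)` to `L₂(0, 2T)` by oddness with respect to
`t = T`. -/
def IsOddExtensionOperator (T : ℝ) (S : OuterSpace T →L[ℝ] OuterSpace (2 * T)) : Prop :=
  ∀ f : OuterSpace T, ∀ᵐ t ∂(outerMeasure (2 * T)),
    S f t = if t ≤ T then f t else - f (2 * T - t)

/-- The connecting operator `C^T = (W^T)^* W^T` built from the control operator. -/
def connectingOperator {ρ : ℝ → ℝ} {T : ℝ} (W : OuterSpace T →L[ℝ] InnerSpace ρ T) :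
    OuterSpace T →L[ℝ] OuterSpace T :=
  (ContinuousLinearMap.adjoint W) ∘L W

end NeumannWave

end

open NeumannWave

open scoped Topology

namespace NeumannWave

/-! This is Blagoveshchenskii's argument. For smooth controls `f`, `g` supported in (0,T), consider
the two-time function E(s,t) = ∫ ρ u^f(·,s) u^g(·,t) dx, for which E(T,T) = (C^T f, g). The wave
equation and Green's formula in x give E_ss − E_tt = u^f(0,s) g(t) − f(s) u^g(0,t)
(`IsWaveKernel.green`). Replace u^f by the retarded minus the advanced wave of `f`. Both have
Neumann datum f, so the term with f(s) drops out (`green_odd`); at time T the advanced wave is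
already zero, so E(T,T) is unchanged. The new E solves E_ss − E_tt = w(s) g(t), with w the boundary
trace of this difference, and vanishes for t ≤ 0. Integration along s + t = const
(`oddEnergy_deriv_add`) and then along s = t (`energy_eq`) gives E(T,T) = −∫ (½ ∫_y^{2T−y} w) g(y)
dy. Since w is `f` convolved with the odd extension of r(0,·), the stretch from y − s to |y − s|
cancels, and the stated kernel remains (`integral_oddConv`).

The kernel r jumps at the front and solves its equation only weakly. Convolving it with a smooth
control moves all time derivatives onto the control. At a fixed time a weak Neumann problem for an
ODE in x is left, and its solutions are classical (`eq_integral_of_weak_neumann`).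

All operators are bounded, so test controls determine C^T (`connectingOperator_eq`). For the
factorization let P be the primitive of r(0,·). Then R J is convolution with P, and S^* sends u to
u(t) − u(2T − t). A direct computation of ½ S^* R J S produces the same kernel
(`response_integration_odd`). -/

/-! ### Weak solutions of the Neumann problem for U'' = F on the half-line. -/

theorem exists_antiderivative_supported {a b : ℝ} {Y : ℝ → ℝ} (hY : ContDiff ℝ ∞ Y)
    (hs : ∀ x ∉ Icc a b, Y x = 0) (h0 : ∫ x in a..b, Y x = 0) :
    ∃ Z : ℝ → ℝ, ContDiff ℝ ∞ Z ∧ (∀ x, HasDerivAt Z (Y x) x) ∧ ∀ x ∉ Icc a b, Z x = 0 := by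
  have hd : ∀ x, HasDerivAt (fun x => ∫ s in a..x, Y s) (Y x) x := fun x =>
    intervalIntegral.integral_hasDerivAt_right (hY.continuous.intervalIntegrable _ _)
      hY.continuous.aestronglyMeasurable.stronglyMeasurableAtFilter hY.continuous.continuousAt
  refine ⟨fun x => ∫ s in a..x, Y s, ?_, hd, ?_⟩
  · rw [contDiff_infty_iff_deriv]
    refine ⟨fun x => (hd x).differentiableAt, ?_⟩
    have : deriv (fun x => ∫ s in a..x, Y s) = Y := funext fun x => (hd x).deriv
    rwa [this]
  · intro x hx
    have hz : ∀ u v : ℝ, (∀ s ∈ uIoo u v, Y s = 0) → ∫ s in u..v, Y s = 0 := by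
      intro u v h
      rw [intervalIntegral.integral_congr_ae (g := fun _ => 0)]
      · simp
      · have h1 : ∀ᵐ s : ℝ, s ≠ max u v := by simp [ae_iff]
        filter_upwards [h1] with s h1 hs
        exact h s ⟨hs.1, lt_of_le_of_ne hs.2 h1⟩
    rcases lt_or_ge x a with h | h
    · refine hz a x fun s hs' => hs s fun h' => ?_
      rw [uIoo_of_ge h.le] at hs'
      exact absurd h'.1 (not_le.2 hs'.2)
    · have hb : b < x := by
        by_contra hb
        exact hx ⟨h, not_lt.1 hb⟩
      have := hz b x fun s hs' => hs s fun h' => by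
        rw [uIoo_of_le hb.le] at hs'
        exact absurd h'.2 (not_le.2 hs'.1)
      change ∫ s in a..x, Y s = 0
      rw [← intervalIntegral.integral_add_adjacent_intervals
        (hY.continuous.intervalIntegrable a b) (hY.continuous.intervalIntegrable b x), h0, this,
        add_zero]

/-- A continuous function on the closed half-line that is orthogonal to all test functions with zero mean
is constant. -/
theorem eq_const_of_integral_mul_eq_zero {D : ℝ → ℝ} (hD : ContinuousOn D (Ici 0))
    (h : ∀ a b : ℝ, 0 < a → a ≤ b → ∀ Y : ℝ → ℝ, ContDiff ℝ ∞ Y → (∀ x ∉ Icc a b, Y x = 0) →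
      ∫ x in a..b, Y x = 0 → ∫ x in Ioi 0, D x * Y x = 0) :
    ∀ x, 0 ≤ x → D x = D 0 := by
  -- a bump with unit mass inside the half-line
  let B : ContDiffBump (2 : ℝ) := ⟨1 / 2, 1, by norm_num, by norm_num⟩
  set η : ℝ → ℝ := B.normed volume with hη
  have hη1 : ∫ x, η x = 1 := B.integral_normed
  have hηs : ContDiff ℝ ∞ η := B.contDiff_normed
  have hη0 : ∀ x ∉ Icc (1 : ℝ) 3, η x = 0 := by
    intro x hx
    by_contra hne
    have : x ∈ Function.support η := hne
    rw [hη, B.support_normed_eq, Metric.mem_ball, Real.dist_eq, abs_lt] at this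
    simp only [B] at this
    exact hx ⟨by linarith [this.1], by linarith [this.2]⟩
  have hint : ∀ Y : ℝ → ℝ, Continuous Y → ∀ a b : ℝ, 0 < a → (∀ x ∉ Icc a b, Y x = 0) →
      IntegrableOn (fun x => D x * Y x) (Ioi 0) := by
    intro Y hY a b ha hs
    have h1 : IntegrableOn (fun x => D x * Y x) (Icc a b) :=
      ((hD.mono fun x hx => le_trans ha.le hx.1).mul hY.continuousOn).integrableOn_Icc
    refine (integrableOn_iff_integrable_of_support_subset
      (Function.support_subset_iff'.2 fun x hx => ?_)).1 h1 |>.integrableOn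
    simp [hs x hx]
  have hmass : ∀ Y : ℝ → ℝ, ∀ a b : ℝ, a ≤ b → (∀ x ∉ Icc a b, Y x = 0) →
      ∫ x in a..b, Y x = ∫ x, Y x := by
    intro Y a b hab hs
    rw [intervalIntegral.integral_of_le hab, ← integral_Icc_eq_integral_Ioc]
    exact setIntegral_eq_integral_of_forall_compl_eq_zero fun x hx => hs x hx
  set c : ℝ := ∫ x in Ioi 0, D x * η x with hc
  have key : ∀ᵐ x : ℝ, x ∈ Ioi (0 : ℝ) → D x - c = 0 := by
    refine isOpen_Ioi.ae_eq_zero_of_integral_contDiff_smul_eq_zero (E := ℝ) (F := ℝ) ?_ ?_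
    · refine ContinuousOn.locallyIntegrableOn ?_ measurableSet_Ioi
      exact (hD.mono Ioi_subset_Ici_self).sub continuousOn_const
    · intro g hg hgc hgs
      -- an interval containing the supports of `g` and of the bump
      obtain ⟨a, ha, b, hab, hgab⟩ : ∃ a : ℝ, 0 < a ∧ ∃ b : ℝ, a ≤ b ∧
          ((∀ x ∉ Icc a b, g x = 0) ∧ ∀ x ∉ Icc a b, η x = 0) := by
        obtain ⟨b₀, hb₀⟩ := hgc.isCompact.bddAbove
        have hlow : ∃ a₀ : ℝ, 0 < a₀ ∧ ∀ x ∈ tsupport g, a₀ ≤ x := by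
          rcases (tsupport g).eq_empty_or_nonempty with he | hne
          · exact ⟨1, one_pos, by simp [he]⟩
          · obtain ⟨m, hm, hmin⟩ := hgc.isCompact.exists_isLeast hne
            exact ⟨m, hgs hm, fun x hx => hmin hx⟩
        obtain ⟨a₀, ha₀, hlow⟩ := hlow
        refine ⟨min a₀ 1, lt_min ha₀ one_pos, max b₀ 3, ?_, ?_, ?_⟩
        · exact (min_le_right _ _).trans ((by norm_num : (1 : ℝ) ≤ 3).trans (le_max_right _ _))
        · intro x hx
          refine image_eq_zero_of_notMem_tsupport fun hx' => hx ⟨?_, ?_⟩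
          · exact (min_le_left _ _).trans (hlow x hx')
          · exact (hb₀ hx').trans (le_max_left _ _)
        · intro x hx
          refine hη0 x fun hx' => hx ⟨?_, ?_⟩
          · exact (min_le_right _ _).trans hx'.1
          · exact hx'.2.trans (le_max_right _ _)
      obtain ⟨hg0, hηab⟩ := hgab
      set m := ∫ x, g x with hm
      -- Du Bois-Reymond's trick: subtracting m·η makes the mean of g zero, and orthogonality to g −
      -- mη says that D − c is orthogonal to g.
      have hYs : ∀ x ∉ Icc a b, g x - m * η x = 0 := fun x hx => by
        rw [hg0 x hx, hηab x hx]; simp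
      have hgi : Integrable g := hg.continuous.integrable_of_hasCompactSupport hgc
      have hηi : Integrable η := B.integrable_normed
      have h1 := h a b ha hab (fun x => g x - m * η x) (hg.sub (contDiff_const.mul hηs)) hYs (by
        rw [hmass _ a b hab hYs, integral_sub hgi (hηi.const_mul m), integral_const_mul, hη1]
        simp [hm])
      have e1 : ∫ x in Ioi 0, D x * (g x - m * η x) = (∫ x in Ioi 0, D x * g x) - m * c := by
        rw [hc, ← integral_const_mul, ← integral_sub (hint g hg.continuous a b ha hg0)
          ((hint η hηs.continuous a b ha hηab).const_mul m)]
        exact integral_congr_ae (ae_of_all _ fun x => by ring)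
      have e2 : ∫ x, g x • (D x - c) = ∫ x in Ioi 0, (D x * g x - c * g x) := by
        rw [← setIntegral_eq_integral_of_forall_compl_eq_zero (s := Ioi (0 : ℝ))]
        · exact integral_congr_ae (ae_of_all _ fun x => by simp only [smul_eq_mul]; ring)
        · intro x hx
          rw [image_eq_zero_of_notMem_tsupport fun hx' => hx (hgs hx'), zero_smul]
      have e3 : ∫ x in Ioi 0, g x = m :=
        setIntegral_eq_integral_of_forall_compl_eq_zero fun x hx =>
          image_eq_zero_of_notMem_tsupport fun hx' => hx (hgs hx')
      rw [e2, integral_sub (hint g hg.continuous a b ha hg0) (hgi.integrableOn.const_mul c),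
        integral_const_mul, e3]
      linarith
  have hEq : EqOn D (fun _ => c) (Ici 0) := by
    refine Measure.eqOn_of_ae_eq (μ := volume) ?_ hD continuousOn_const ?_
    · rw [EventuallyEq, ae_restrict_iff' measurableSet_Ici]
      have h1 : ∀ᵐ s : ℝ, s ≠ 0 := by simp [ae_iff]
      filter_upwards [key, h1] with x hx h1 h2
      exact sub_eq_zero.1 (hx (lt_of_le_of_ne h2 (Ne.symm h1)))
    · rw [interior_Ici, closure_Ioi]
  intro x hx
  rw [hEq hx, hEq (mem_Ici.2 le_rfl)]

/-- Lagrange's identity on `[0, b]` for functions given through their second derivatives. -/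
theorem integral_lagrange {b c d : ℝ} (hb : 0 ≤ b) {F G U V U' V' : ℝ → ℝ}
    (hF : ContinuousOn F (Ici 0)) (hG : ContinuousOn G (Ici 0))
    (hU : ∀ x, 0 ≤ x → U x = U 0 + ∫ s in (0 : ℝ)..x, U' s)
    (hU' : ∀ x, 0 ≤ x → U' x = c + ∫ s in (0 : ℝ)..x, F s)
    (hV : ∀ x, 0 ≤ x → V x = V 0 + ∫ s in (0 : ℝ)..x, V' s)
    (hV' : ∀ x, 0 ≤ x → V' x = d + ∫ s in (0 : ℝ)..x, G s) :
    ∫ x in (0 : ℝ)..b, (F x * V x - U x * G x)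
      = (U' b * V b - U b * V' b) - (c * V 0 - U 0 * d) := by
  have aux : ∀ (P p : ℝ → ℝ) (k : ℝ), ContinuousOn p (Ici 0) →
      (∀ x, 0 ≤ x → P x = k + ∫ s in (0 : ℝ)..x, p s) →
      ContinuousOn P (Ici 0) ∧ ∀ x, 0 < x → HasDerivAt P (p x) x := by
    intro P p k hp hP
    have hder : ∀ x, 0 < x → HasDerivAt P (p x) x := by
      intro x hx
      have h1 : HasDerivAt (fun x => k + ∫ s in (0 : ℝ)..x, p s) (p x) x := by
        refine (intervalIntegral.integral_hasDerivAt_right ?_ ?_ ?_).const_add k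
        · refine (hp.mono ?_).intervalIntegrable
          rw [uIcc_of_le hx.le]
          exact Icc_subset_Ici_self
        · exact (hp.mono Ioi_subset_Ici_self).stronglyMeasurableAtFilter isOpen_Ioi x hx
        · exact hp.continuousAt (Ici_mem_nhds hx)
      refine h1.congr_of_eventuallyEq ?_
      filter_upwards [Ici_mem_nhds hx] with y hy using hP y hy
    refine ⟨fun x hx => ?_, hder⟩
    rcases eq_or_lt_of_le (mem_Ici.1 hx) with h | h
    · subst h
      have h2 : ContinuousOn (fun x => k + ∫ s in (0 : ℝ)..x, p s) (Icc 0 1) := by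
        refine continuousOn_const.add ?_
        have := intervalIntegral.continuousOn_primitive_interval (μ := volume) (f := p)
          (a := 0) (b := 1) ?_
        · rwa [uIcc_of_le zero_le_one] at this
        · rw [uIcc_of_le zero_le_one]
          exact (hp.mono Icc_subset_Ici_self).integrableOn_Icc
      have h3 : ContinuousWithinAt P (Icc 0 1) 0 :=
        (h2 0 ⟨le_rfl, zero_le_one⟩).congr (fun y hy => hP y hy.1) (hP 0 le_rfl)
      exact h3.mono_of_mem_nhdsWithin (Icc_mem_nhdsGE one_pos)
    · exact (hder x h).continuousAt.continuousWithinAt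
  obtain ⟨cU', dU'⟩ := aux U' F c hF hU'
  obtain ⟨cV', dV'⟩ := aux V' G d hG hV'
  obtain ⟨cU, dU⟩ := aux U U' (U 0) cU' hU
  obtain ⟨cV, dV⟩ := aux V V' (V 0) cV' hV
  have hsub : Icc 0 b ⊆ Ici (0 : ℝ) := Icc_subset_Ici_self
  have := intervalIntegral.integral_eq_sub_of_hasDerivAt_of_le (a := 0) (b := b)
    (f := fun x => U' x * V x - U x * V' x) (f' := fun x => F x * V x - U x * G x) hb
    (((cU'.mul cV).sub (cU.mul cV')).mono hsub) (fun x hx => by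
      have := (((dU' x hx.1).mul (dV x hx.1)).sub ((dU x hx.1).mul (dV' x hx.1)))
      refine (this.congr_deriv ?_)
      ring) (by
      refine ContinuousOn.intervalIntegrable ?_
      rw [uIcc_of_le hb]
      exact ((hF.mul cV).sub (cU.mul hG)).mono hsub)
  rw [this]
  have e1 : U' 0 = c := by simpa using hU' 0 le_rfl
  have e2 : V' 0 = d := by simpa using hV' 0 le_rfl
  simp only [e1, e2]

/-- A weak solution of `U'' = F` on the half-line with Neumann datum `U'(0) = c` is a classical
one. -/
theorem eq_integral_of_weak_neumann {U F : ℝ → ℝ} {c : ℝ} (hU : ContinuousOn U (Ici 0))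
    (hF : ContinuousOn F (Ici 0))
    (h : ∀ X : ℝ → ℝ, ContDiff ℝ ∞ X → HasCompactSupport X → deriv X 0 = 0 →
      ∫ x in Ioi 0, (F x * X x - U x * deriv (deriv X) x) = - (X 0 * c)) :
    ∀ x, 0 ≤ x → U x = U 0 + ∫ s in (0 : ℝ)..x, (c + ∫ y in (0 : ℝ)..s, F y) := by
  -- V is the classical solution with V(0) = 0 and V'(0) = c; it remains to see that U − V is
  -- constant.
  set V' : ℝ → ℝ := fun s => c + ∫ y in (0 : ℝ)..s, F y with hV'
  set V : ℝ → ℝ := fun x => ∫ s in (0 : ℝ)..x, V' s with hV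
  have hcont : ∀ p : ℝ → ℝ, ContinuousOn p (Ici 0) →
      ContinuousOn (fun x => ∫ s in (0 : ℝ)..x, p s) (Ici 0) := by
    intro p hp x hx
    have h2 : ContinuousOn (fun x => ∫ s in (0 : ℝ)..x, p s) (Icc 0 (x + 1)) := by
      have := intervalIntegral.continuousOn_primitive_interval (μ := volume) (f := p)
          (a := 0) (b := x + 1) ?_
      · rwa [uIcc_of_le (by linarith [mem_Ici.1 hx])] at this
      · rw [uIcc_of_le (by linarith [mem_Ici.1 hx])]
        exact (hp.mono Icc_subset_Ici_self).integrableOn_Icc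
    refine (h2 x ⟨hx, by linarith⟩).mono_of_mem_nhdsWithin ?_
    filter_upwards [self_mem_nhdsWithin, mem_nhdsWithin_of_mem_nhds (Iic_mem_nhds (lt_add_one x))]
      with y h1 h2 using ⟨h1, h2⟩
  have cV' : ContinuousOn V' (Ici 0) := continuousOn_const.add (hcont F hF)
  have cV : ContinuousOn V (Ici 0) := hcont V' cV'
  have hV0 : V 0 = 0 := by simp [hV]
  have := eq_const_of_integral_mul_eq_zero (hU.sub cV) ?_
  · intro x hx
    have := this x hx
    simp only [Pi.sub_apply, hV0] at this
    change U x = U 0 + V x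
    linarith
  intro a b ha hab Y hY hYs hY0
  obtain ⟨Z, hZ, hZd, hZs⟩ := exists_antiderivative_supported hY hYs hY0
  have hbpos : 0 ≤ b := by linarith
  -- X is the even test function with X'' = Y for x > 0. Its derivative is odd, so X'(0) = 0 and X
  -- has compact support without a second moment condition on Y. This is why only constants, and no
  -- linear functions, escape the test.
  obtain ⟨X, hX, hXd, hXs⟩ := exists_antiderivative_supported (a := -b) (b := b)
      (Y := fun x => Z x - Z (-x))
    (hZ.sub (hZ.comp contDiff_neg)) (by
      intro x hx
      rw [hZs x fun h' => hx ⟨by linarith [h'.1], h'.2⟩,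
        hZs (-x) fun h' => hx ⟨by linarith [h'.2], by linarith [h'.1]⟩, sub_zero]) (by
      rw [intervalIntegral.integral_sub (hZ.continuous.intervalIntegrable _ _)
        (Continuous.intervalIntegrable (by have := hZ.continuous; fun_prop) _ _),
        intervalIntegral.integral_comp_neg (fun x => Z x)]
      simp)
  have dX : deriv X = fun x => Z x - Z (-x) := funext fun x => (hXd x).deriv
  have hXc : HasCompactSupport X := HasCompactSupport.intro isCompact_Icc hXs
  have h1 := h X hX hXc (by rw [dX]; simp)
  have ddX : ∀ x, 0 < x → deriv (deriv X) x = Y x := by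
    intro x hx
    have : deriv X =ᶠ[𝓝 x] Z := by
      filter_upwards [Ioi_mem_nhds hx] with y hy
      rw [dX]
      simp only
      rw [hZs (-y) fun h' => by linarith [h'.1, mem_Ioi.1 hy], sub_zero]
    rw [this.deriv_eq, (hZd x).deriv]
  have hY0' : Y 0 = 0 := hYs 0 fun h' => by linarith [h'.1]
  have hZ0 : Z 0 = 0 := hZs 0 fun h' => by linarith [h'.1]
  have hvan : ∀ x, b < x → X x = 0 ∧ Y x = 0 := fun x hx =>
    ⟨hXs x fun h' => by linarith [h'.2], hYs x fun h' => by linarith [h'.2]⟩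
  have hset : ∀ f : ℝ → ℝ, (∀ x, b < x → f x = 0) →
      ∫ x in Ioi 0, f x = ∫ x in (0 : ℝ)..b, f x := by
    intro f hf
    rw [intervalIntegral.integral_of_le hbpos]
    refine setIntegral_eq_of_subset_of_forall_sdiff_eq_zero measurableSet_Ioi
      (fun x hx => hx.1) ?_
    intro x hx
    refine hf x ?_
    by_contra h'
    exact hx.2 ⟨hx.1, not_lt.1 h'⟩
  have e1 : ∫ x in Ioi 0, (F x * X x - U x * deriv (deriv X) x)
      = ∫ x in (0 : ℝ)..b, (F x * X x - U x * Y x) := by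
    rw [setIntegral_congr_fun (g := fun x => F x * X x - U x * Y x) measurableSet_Ioi]
    · exact hset _ fun x hx => by simp [hvan x hx]
    · intro x hx
      simp only [ddX x hx]
  have hXint : ∀ x, 0 ≤ x → X x = X 0 + ∫ s in (0 : ℝ)..x, Z s := by
    intro x hx
    have := intervalIntegral.integral_eq_sub_of_hasDerivAt_of_le (a := 0) (b := x) (f := X)
      (f' := Z) hx hX.continuous.continuousOn (fun y hy => by
        have := hXd y
        rwa [hZs (-y) fun h' => by linarith [h'.1, hy.1], sub_zero] at this)
      (hZ.continuous.intervalIntegrable _ _)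
    linarith
  have hZint : ∀ x, 0 ≤ x → Z x = 0 + ∫ s in (0 : ℝ)..x, Y s := by
    intro x hx
    rw [intervalIntegral.integral_eq_sub_of_hasDerivAt (fun y _ => hZd y)
      (hY.continuous.intervalIntegrable _ _), hZ0]
    ring
  have e2 := integral_lagrange hbpos hF hY.continuous.continuousOn (U := V) (U' := V') (V := X)
    (V' := Z) (c := c) (d := 0) (fun x _ => by rw [hV0, zero_add]) (fun x _ => rfl) hXint hZint
  have hXb : X b = 0 := by
    have : Tendsto X (𝓝[>] b) (𝓝 (X b)) := hX.continuous.continuousWithinAt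
    refine tendsto_nhds_unique this (tendsto_const_nhds.congr' ?_)
    filter_upwards [self_mem_nhdsWithin] with x hx using (hvan x hx).1.symm
  have hZb : Z b = 0 := by
    have : Tendsto Z (𝓝[>] b) (𝓝 (Z b)) := hZ.continuous.continuousWithinAt
    refine tendsto_nhds_unique this (tendsto_const_nhds.congr' ?_)
    filter_upwards [self_mem_nhdsWithin] with x hx
      using (hZs x fun h' => absurd h'.2 (not_le.2 hx)).symm
  rw [hXb, hZb, hV0] at e2
  have hint : ∀ P Q : ℝ → ℝ, ContinuousOn P (Ici 0) → Continuous Q →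
      IntervalIntegrable (fun x => P x * Q x) volume 0 b := by
    intro P Q hP hQ
    refine ContinuousOn.intervalIntegrable ?_
    rw [uIcc_of_le hbpos]
    exact (hP.mono Icc_subset_Ici_self).mul hQ.continuousOn
  rw [hset _ fun x hx => by simp [hvan x hx]]
  rw [e1, intervalIntegral.integral_sub (hint F X hF hX.continuous) (hint U Y hU hY.continuous)]
    at h1
  rw [intervalIntegral.integral_sub (hint F X hF hX.continuous) (hint V Y cV hY.continuous)] at e2
  have e3 : ∫ x in (0 : ℝ)..b, (U - V) x * Y x
      = (∫ x in (0 : ℝ)..b, U x * Y x) - ∫ x in (0 : ℝ)..b, V x * Y x := by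
    rw [← intervalIntegral.integral_sub (hint U Y hU hY.continuous) (hint V Y cV hY.continuous)]
    exact intervalIntegral.integral_congr fun x _ => by simp only [Pi.sub_apply]; ring
  rw [e3]
  linarith

/-! ### Waves as time convolutions, and Green's formula. -/

/-- The properties of the fundamental solution, extended by zero outside its sector, that the
energy argument needs. -/
structure IsWaveKernel (p q : ℝ → ℝ) (k : ℝ → ℝ → ℝ) : Prop where
  continuous_density : Continuous p
  continuous_potential : Continuous q
  measurable : Measurable (Function.uncurry k)
  -- Finite propagation speed: up to time M the kernel lives over a bounded interval.
  bound : ∀ M : ℝ, ∃ C L : ℝ, 0 ≤ C ∧ 0 ≤ L ∧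
    ∀ x t, t ≤ M → |k x t| ≤ (Icc 0 L).indicator (fun _ => C) x
  eq_zero : ∀ x t, t < 0 → k x t = 0
  -- Almost every t only, because the kernel may jump at the front.
  continuousWithinAt : ∀ x₀, 0 ≤ x₀ → ∀ᵐ t, ContinuousWithinAt (fun x => k x t) (Ici 0) x₀
  weak : ∀ X Θ : ℝ → ℝ, ContDiff ℝ ∞ X → HasCompactSupport X → deriv X 0 = 0 →
    ContDiff ℝ ∞ Θ → HasCompactSupport Θ →
    ∫ y : ℝ × ℝ, k y.1 y.2 * (p y.1 * (X y.1 * deriv (deriv Θ) y.2)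
      - deriv (deriv X) y.1 * Θ y.2 + q y.1 * (X y.1 * Θ y.2)) = - (X 0 * Θ 0)

/-- The convolution in time of a kernel with a control. -/
noncomputable def conv (k : ℝ → ℝ → ℝ) (f : ℝ → ℝ) (x z : ℝ) : ℝ := ∫ t, k x t * f (z - t)

namespace IsWaveKernel

variable {p q : ℝ → ℝ} {k : ℝ → ℝ → ℝ} {f g : ℝ → ℝ}

theorem exists_support_bound (hf : HasCompactSupport f) :
    ∃ m : ℝ, 0 ≤ m ∧ ∀ x, m < |x| → f x = 0 := by
  obtain ⟨m, hm⟩ := hf.isCompact.isBounded.exists_norm_le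
  refine ⟨max m 0, le_max_right _ _, fun x hx => ?_⟩
  refine image_eq_zero_of_notMem_tsupport fun h => ?_
  have := hm x h
  rw [Real.norm_eq_abs] at this
  exact absurd ((le_max_left m 0).trans_lt hx) (not_lt.2 this)

theorem locallyIntegrable_uncurry (hk : IsWaveKernel p q k) :
    LocallyIntegrable (Function.uncurry k) (volume : Measure (ℝ × ℝ)) := by
  rw [locallyIntegrable_iff]
  intro K hK
  obtain ⟨M, hM⟩ := (hK.image continuous_snd).bddAbove
  obtain ⟨C, L, hC, hL, hb⟩ := hk.bound M
  refine Measure.integrableOn_of_bounded (M := C) hK.measure_lt_top.ne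
    hk.measurable.aestronglyMeasurable ?_
  rw [ae_restrict_iff' hK.measurableSet]
  refine ae_of_all _ fun y hy => ?_
  refine (hb y.1 y.2 (hM ⟨y, hy, rfl⟩)).trans ?_
  exact indicator_le_self' (fun _ _ => hC) _

theorem locallyIntegrable (hk : IsWaveKernel p q k) (x : ℝ) : LocallyIntegrable (k x) := by
  rw [locallyIntegrable_iff]
  intro K hK
  obtain ⟨M, hM⟩ := hK.bddAbove
  obtain ⟨C, L, hC, hL, hb⟩ := hk.bound M
  refine Measure.integrableOn_of_bounded (M := C) hK.measure_lt_top.ne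
    (hk.measurable.comp measurable_prodMk_left).aestronglyMeasurable ?_
  rw [ae_restrict_iff' hK.measurableSet]
  refine ae_of_all _ fun t ht => ?_
  refine (hb x t (hM ht)).trans ?_
  exact indicator_le_self' (fun _ _ => hC) _

theorem hasCompactSupport_sub_left (hf : HasCompactSupport f) (z : ℝ) :
    HasCompactSupport fun t => f (z - t) :=
  hf.comp_homeomorph (Homeomorph.subLeft z)

theorem integrable_mul (hk : IsWaveKernel p q k) (hf : Continuous f) (hfc : HasCompactSupport f)
    (x z : ℝ) : Integrable fun t => k x t * f (z - t) := by
  exact (hk.locallyIntegrable x).integrable_smul_right_of_hasCompactSupport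
    (hf.comp (continuous_const.sub continuous_id)) (hasCompactSupport_sub_left hfc z)

theorem pointwise_bound (hk : IsWaveKernel p q k) (hfc : HasCompactSupport f) (N : ℝ) :
    ∃ C L : ℝ, 0 ≤ C ∧ 0 ≤ L ∧ ∀ x z t, z ≤ N →
      |k x t * f (z - t)| ≤ (Icc 0 L).indicator (fun _ => C) x * |f (z - t)| := by
  obtain ⟨m, hm, hfm⟩ := exists_support_bound hfc
  -- If |z − t| ≤ m and z ≤ N, then t ≤ N + m; for other t the control factor is zero.
  obtain ⟨C, L, hC, hL, hb⟩ := hk.bound (N + m)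
  refine ⟨C, L, hC, hL, fun x z t hz => ?_⟩
  rw [abs_mul]
  by_cases h : m < |z - t|
  · simp [hfm _ h]
  · refine mul_le_mul_of_nonneg_right (hb x t ?_) (abs_nonneg _)
    linarith [neg_abs_le (z - t)]

theorem conv_bound (hk : IsWaveKernel p q k) (hf : Continuous f) (hfc : HasCompactSupport f)
    (N : ℝ) : ∃ C L : ℝ, 0 ≤ C ∧ 0 ≤ L ∧ ∀ x z, z ≤ N →
      |conv k f x z| ≤ (Icc 0 L).indicator (fun _ => C) x := by
  obtain ⟨C, L, hC, hL, hb⟩ := hk.pointwise_bound hfc N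
  have hI : 0 ≤ ∫ t, |f t| := integral_nonneg fun _ => abs_nonneg _
  refine ⟨C * ∫ t, |f t|, L, mul_nonneg hC hI, hL, fun x z hz => ?_⟩
  have hi : Integrable fun t => |f (z - t)| :=
    ((hf.comp (continuous_const.sub continuous_id)).integrable_of_hasCompactSupport
      (hasCompactSupport_sub_left hfc z)).abs
  refine (norm_integral_le_of_norm_le (f := fun t => k x t * f (z - t)) (hi.const_mul ((Icc 0 L).indicator (fun _ => C) x))
    (ae_of_all _ fun t => hb x z t hz)).trans (le_of_eq ?_)
  rw [integral_const_mul, integral_sub_left_eq_self (fun t => |f t|)]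
  by_cases h : x ∈ Icc 0 L <;> simp [h]

theorem conv_eq_zero_of_neg (hk : IsWaveKernel p q k) (hf : Continuous f)
    (hfc : HasCompactSupport f) {x : ℝ} (hx : x < 0) (z : ℝ) : conv k f x z = 0 := by
  obtain ⟨C, L, -, -, h⟩ := hk.conv_bound hf hfc z
  have := h x z le_rfl
  rw [indicator_of_notMem (fun h' => absurd h'.1 (not_le.2 hx))] at this
  exact abs_eq_zero.1 (le_antisymm this (abs_nonneg _))

/-- The convolution vanishes as long as the control has not started. -/
theorem conv_eq_zero_of_control (hk : IsWaveKernel p q k) {z : ℝ} (h : ∀ s ≤ z, f s = 0) (x : ℝ) :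
    conv k f x z = 0 := by
  refine integral_eq_zero_of_ae (ae_of_all _ fun t => ?_)
  rcases lt_or_ge t 0 with ht | ht
  · simp [hk.eq_zero x t ht]
  · simp [h (z - t) (by linarith)]

theorem measurable_conv (hk : IsWaveKernel p q k) (hf : Continuous f) (z : ℝ) :
    Measurable fun x => conv k f x z := by
  have : StronglyMeasurable (Function.uncurry fun x t => k x t * f (z - t)) :=
    (hk.measurable.mul
      ((hf.comp (continuous_const.sub continuous_snd)).measurable)).stronglyMeasurable
  exact this.integral_prod_right.measurable

/-- The kernel is only locally integrable in time, so the derivative is put on the control; hence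
`conv k (deriv (deriv f))` plays the role of u_tt. -/
theorem hasDerivAt_conv (hk : IsWaveKernel p q k) (hf : ContDiff ℝ ∞ f)
    (hfc : HasCompactSupport f) (x z : ℝ) :
    HasDerivAt (fun z => conv k f x z) (conv k (deriv f) x z) z :=
  hfc.hasDerivAt_convolution_right (ContinuousLinearMap.mul ℝ ℝ) (hk.locallyIntegrable x)
    (hf.of_le (by exact_mod_cast le_top)) z

/-- The jump at the front occupies a null set of times for each x₀, so dominated convergence ignores
it. -/
theorem continuousOn_conv (hk : IsWaveKernel p q k) (hf : Continuous f)
    (hfc : HasCompactSupport f) (z : ℝ) : ContinuousOn (fun x => conv k f x z) (Ici 0) := by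
  intro x₀ hx₀
  obtain ⟨C, L, hC, hL, hb⟩ := hk.pointwise_bound hfc z
  refine continuousWithinAt_of_dominated (bound := fun t => C * |f (z - t)|) ?_ ?_ ?_ ?_
  · exact Eventually.of_forall fun x => (hk.integrable_mul hf hfc x z).aestronglyMeasurable
  · refine Eventually.of_forall fun x => ae_of_all _ fun t => (hb x z t le_rfl).trans ?_
    exact mul_le_mul_of_nonneg_right (indicator_le_self' (fun _ _ => hC) _) (abs_nonneg _)
  · exact ((hf.comp (continuous_const.sub continuous_id)).integrable_of_hasCompactSupport
      (hasCompactSupport_sub_left hfc z)).abs.const_mul C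
  · filter_upwards [hk.continuousWithinAt x₀ hx₀] with t ht using ht.mul continuousWithinAt_const

theorem deriv_deriv_sub_left (f : ℝ → ℝ) (z : ℝ) :
    deriv (deriv fun t => f (z - t)) = fun t => deriv (deriv f) (z - t) := by
  have h1 : ∀ g : ℝ → ℝ, deriv (fun t => g (z - t)) = fun t => - deriv g (z - t) := fun g =>
    funext fun t => deriv_comp_const_sub g z t
  rw [h1 f, deriv.fun_neg', h1 (deriv f)]
  simp

/-- The test function X(x) f(z − t) freezes the time at z: Fubini turns the weak wave equation into
a weak ODE in x with Neumann datum f(z). -/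
theorem weak_conv (hk : IsWaveKernel p q k) (hf : ContDiff ℝ ∞ f) (hfc : HasCompactSupport f)
    (z : ℝ) {X : ℝ → ℝ} (hX : ContDiff ℝ ∞ X) (hXc : HasCompactSupport X) (hX0 : deriv X 0 = 0) :
    ∫ x in Ioi 0, ((p x * conv k (deriv (deriv f)) x z + q x * conv k f x z) * X x
      - conv k f x z * deriv (deriv X) x) = - (X 0 * f z) := by
  have hf' : ContDiff ℝ ∞ (deriv f) := (contDiff_infty_iff_deriv.1 hf).2
  have hf'' : ContDiff ℝ ∞ (deriv (deriv f)) := (contDiff_infty_iff_deriv.1 hf').2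
  have hX' : ContDiff ℝ ∞ (deriv X) := (contDiff_infty_iff_deriv.1 hX).2
  have hX'' : ContDiff ℝ ∞ (deriv (deriv X)) := (contDiff_infty_iff_deriv.1 hX').2
  have h := hk.weak X (fun t => f (z - t)) hX hXc hX0 (hf.comp (contDiff_const.sub contDiff_id))
    (hasCompactSupport_sub_left hfc z)
  rw [deriv_deriv_sub_left, sub_zero] at h
  rw [← h, Measure.volume_eq_prod, integral_prod]
  · rw [← integral_Ici_eq_integral_Ioi, setIntegral_eq_integral_of_forall_compl_eq_zero]
    · refine integral_congr_ae (ae_of_all _ fun x => ?_)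
      have i1 := hk.integrable_mul hf''.continuous hfc.deriv.deriv x z
      have i2 := hk.integrable_mul hf.continuous hfc x z
      calc _ = (∫ t, (p x * X x) * (k x t * deriv (deriv f) (z - t)))
            + ∫ t, (q x * X x - deriv (deriv X) x) * (k x t * f (z - t)) := by
            rw [integral_const_mul, integral_const_mul]
            simp only [conv]
            ring
        _ = _ := by
            rw [← integral_add (i1.const_mul _) (i2.const_mul _)]
            refine integral_congr_ae (ae_of_all _ fun t => ?_)
            simp only
            ring
    · intro x hx
      have hx : x < 0 := not_le.1 hx
      simp [hk.conv_eq_zero_of_neg hf.continuous hfc hx,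
        hk.conv_eq_zero_of_neg hf''.continuous hfc.deriv.deriv hx]
  · have hp := hk.continuous_density
    have hq := hk.continuous_potential
    have c1 := hf.continuous
    have c2 := hf''.continuous
    have c3 := hX.continuous
    have c4 := hX''.continuous
    refine hk.locallyIntegrable_uncurry.integrable_smul_right_of_hasCompactSupport
      (g := fun y : ℝ × ℝ => (p y.1 * (X y.1 * deriv (deriv f) (z - y.2))
      - deriv (deriv X) y.1 * f (z - y.2) + q y.1 * (X y.1 * f (z - y.2)))) (by fun_prop) ?_
    refine HasCompactSupport.intro (K := tsupport X ×ˢ tsupport fun t => f (z - t))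
      (hXc.isCompact.prod (hasCompactSupport_sub_left hfc z).isCompact) ?_
    rintro ⟨x, t⟩ hxt
    rw [mem_prod, not_and_or] at hxt
    rcases hxt with hx | ht
    · have h1 : X x = 0 := image_eq_zero_of_notMem_tsupport hx
      have h2 : deriv (deriv X) x = 0 := image_eq_zero_of_notMem_tsupport fun h' =>
        hx (tsupport_deriv_subset (𝕜 := ℝ) (tsupport_deriv_subset (𝕜 := ℝ) h'))
      simp [h1, h2]
    · have h1 : f (z - t) = 0 := image_eq_zero_of_notMem_tsupport (f := fun t => f (z - t)) ht
      have h2 : deriv (deriv f) (z - t) = 0 := by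
        rw [← congrFun (deriv_deriv_sub_left f z) t]
        exact image_eq_zero_of_notMem_tsupport fun h' =>
          ht (tsupport_deriv_subset (𝕜 := ℝ) (tsupport_deriv_subset (𝕜 := ℝ) h'))
      simp [h1, h2]

theorem conv_eq_integral (hk : IsWaveKernel p q k) (hf : ContDiff ℝ ∞ f)
    (hfc : HasCompactSupport f) (z : ℝ) :
    ∀ x, 0 ≤ x → conv k f x z = conv k f 0 z + ∫ s in (0 : ℝ)..x, (f z + ∫ y in (0 : ℝ)..s,
      (p y * conv k (deriv (deriv f)) y z + q y * conv k f y z)) := by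
  have hf' : ContDiff ℝ ∞ (deriv f) := (contDiff_infty_iff_deriv.1 hf).2
  have hf'' : ContDiff ℝ ∞ (deriv (deriv f)) := (contDiff_infty_iff_deriv.1 hf').2
  refine eq_integral_of_weak_neumann (hk.continuousOn_conv hf.continuous hfc z) ?_ ?_
  · exact (hk.continuous_density.continuousOn.mul
      (hk.continuousOn_conv hf''.continuous hfc.deriv.deriv z)).add
      (hk.continuous_potential.continuousOn.mul (hk.continuousOn_conv hf.continuous hfc z))
  · exact fun X hX hXc hX0 => hk.weak_conv hf hfc z hX hXc hX0

theorem integrable_density_mul (hk : IsWaveKernel p q k) (hf : Continuous f)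
    (hfc : HasCompactSupport f) (hg : Continuous g) (hgc : HasCompactSupport g) (s t : ℝ) :
    Integrable fun x => p x * (conv k f x s * conv k g x t) := by
  obtain ⟨C, L, hC, hL, hb⟩ := hk.conv_bound hf hfc s
  obtain ⟨D, M, hD, hM, hd⟩ := hk.conv_bound hg hgc t
  have hi : Integrable fun x => (Icc 0 L).indicator (fun x => |p x| * (C * D)) x :=
    ((hk.continuous_density.abs.mul continuous_const).continuousOn.integrableOn_Icc).integrable_indicator
      measurableSet_Icc
  refine hi.mono' (hk.continuous_density.measurable.mul
    ((hk.measurable_conv hf s).mul (hk.measurable_conv hg t))).aestronglyMeasurable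
    (ae_of_all _ fun x => ?_)
  have h1 := hb x s le_rfl
  have h2 := (hd x t le_rfl).trans (indicator_le_self' (fun _ _ => hD) _)
  rw [Real.norm_eq_abs, abs_mul, abs_mul]
  by_cases hx : x ∈ Icc 0 L
  · rw [indicator_of_mem hx] at h1 ⊢
    gcongr
  · rw [indicator_of_notMem hx] at h1 ⊢
    rw [le_antisymm h1 (abs_nonneg _)]
    simp

/-- Green's formula for two waves observed at different times. -/
theorem green (hk : IsWaveKernel p q k) (hf : ContDiff ℝ ∞ f) (hfc : HasCompactSupport f)
    (hg : ContDiff ℝ ∞ g) (hgc : HasCompactSupport g) (s t : ℝ) :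
    (∫ x, p x * (conv k (deriv (deriv f)) x s * conv k g x t))
      - ∫ x, p x * (conv k f x s * conv k (deriv (deriv g)) x t)
      = conv k f 0 s * g t - f s * conv k g 0 t := by
  have hf'' : ContDiff ℝ ∞ (deriv (deriv f)) :=
    (contDiff_infty_iff_deriv.1 (contDiff_infty_iff_deriv.1 hf).2).2
  have hg'' : ContDiff ℝ ∞ (deriv (deriv g)) :=
    (contDiff_infty_iff_deriv.1 (contDiff_infty_iff_deriv.1 hg).2).2
  have hzero : ∀ h : ℝ → ℝ, Continuous h → HasCompactSupport h → ∀ z : ℝ, ∃ L, 0 ≤ L ∧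
      ∀ x, L < x → conv k h x z = 0 := by
    intro h hh hhc z
    obtain ⟨C, L, hC, hL, hb⟩ := hk.conv_bound hh hhc z
    refine ⟨L, hL, fun x hx => ?_⟩
    have := hb x z le_rfl
    rw [indicator_of_notMem fun h' => absurd h'.2 (not_le.2 hx)] at this
    exact abs_eq_zero.1 (le_antisymm this (abs_nonneg _))
  obtain ⟨L₁, hL₁, z₁⟩ := hzero f hf.continuous hfc s
  obtain ⟨L₂, hL₂, z₂⟩ := hzero g hg.continuous hgc t
  -- Beyond both wave fronts the boundary terms at b vanish, so only those at x = 0 survive.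
  obtain ⟨b, hb1, hb2⟩ : ∃ b, L₁ < b ∧ L₂ < b :=
    ⟨max L₁ L₂ + 1, by linarith [le_max_left L₁ L₂], by linarith [le_max_right L₁ L₂]⟩
  have hb : 0 ≤ b := hL₁.trans hb1.le
  have hc : ∀ (h : ℝ → ℝ) (z : ℝ), ContDiff ℝ ∞ h → HasCompactSupport h →
      ContDiff ℝ ∞ (deriv (deriv h)) → ContinuousOn (fun y =>
        p y * conv k (deriv (deriv h)) y z + q y * conv k h y z) (Ici 0) := by
    intro h z hh hhc hh''
    exact (hk.continuous_density.continuousOn.mul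
      (hk.continuousOn_conv hh''.continuous hhc.deriv.deriv z)).add
      (hk.continuous_potential.continuousOn.mul (hk.continuousOn_conv hh.continuous hhc z))
  have key := integral_lagrange hb (hc f s hf hfc hf'') (hc g t hg hgc hg'')
    (hk.conv_eq_integral hf hfc s) (fun _ _ => rfl) (hk.conv_eq_integral hg hgc t)
    (fun _ _ => rfl)
  simp only [z₁ b hb1, z₂ b hb2] at key
  rw [← integral_sub (hk.integrable_density_mul hf''.continuous hfc.deriv.deriv hg.continuous hgc
    s t) (hk.integrable_density_mul hf.continuous hfc hg''.continuous hgc.deriv.deriv s t)]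
  rw [intervalIntegral.integral_of_le hb, ← integral_Icc_eq_integral_Ioc] at key
  rw [← setIntegral_eq_integral_of_forall_compl_eq_zero (s := Icc 0 b)]
  -- The potential enters both waves in the same way and cancels.
  · have e : ∀ x, p x * (conv k (deriv (deriv f)) x s * conv k g x t)
        - p x * (conv k f x s * conv k (deriv (deriv g)) x t)
        = (p x * conv k (deriv (deriv f)) x s + q x * conv k f x s) * conv k g x t
        - conv k f x s * (p x * conv k (deriv (deriv g)) x t + q x * conv k g x t) := by
      intro x
      ring
    simp only [e, key]
    ring
  · intro x hx
    rcases lt_or_ge x 0 with h | h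
    · rw [hk.conv_eq_zero_of_neg hg.continuous hgc h, hk.conv_eq_zero_of_neg hf.continuous hfc h]
      simp
    · have : b < x := by
        by_contra h'
        exact hx ⟨h, not_lt.1 h'⟩
      rw [z₁ x (hb1.trans this), z₂ x (hb2.trans this)]
      simp

end IsWaveKernel

/-- Fubini on a triangle. Integrability suffices in place of continuity because the lemma is also
applied to a discontinuous kernel times an L₂ control. -/
theorem integral_integral_triangle {h : ℝ → ℝ → ℝ} {T : ℝ} (hT : 0 ≤ T)
    (hc : IntegrableOn (Function.uncurry h) (Ioc 0 T ×ˢ Ioc 0 T)) :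
    ∫ w in (0 : ℝ)..T, ∫ y in (0 : ℝ)..w, h w y = ∫ y in (0 : ℝ)..T, ∫ w in y..T, h w y := by
  set H : ℝ → ℝ → ℝ := fun w y => {p : ℝ × ℝ | p.2 ≤ p.1}.indicator (Function.uncurry h) (w, y)
    with hH
  have hms : MeasurableSet {p : ℝ × ℝ | p.2 ≤ p.1} := measurableSet_le measurable_snd measurable_fst
  have hint : Integrable (Function.uncurry H)
      ((volume.restrict (Ioc 0 T)).prod (volume.restrict (Ioc 0 T))) := by
    have h2 := Integrable.indicator hc hms
    rwa [Measure.volume_eq_prod, ← Measure.prod_restrict] at h2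
  have e1 : ∀ w ∈ Ioc 0 T, ∫ y in (0 : ℝ)..w, h w y = ∫ y in Ioc 0 T, H w y := by
    intro w hw
    rw [intervalIntegral.integral_of_le hw.1.le]
    have : ∀ y, H w y = (Iic w).indicator (h w) y := fun y => by
      by_cases hy : y ≤ w <;> simp [hH, hy]
    simp only [this]
    rw [setIntegral_indicator measurableSet_Iic]
    congr 2
    ext y
    constructor
    · exact fun hy => ⟨⟨hy.1, hy.2.trans hw.2⟩, hy.2⟩
    · exact fun hy => ⟨hy.1.1, hy.2⟩
  have e2 : ∀ y ∈ Ioc 0 T, ∫ w in y..T, h w y = ∫ w in Ioc 0 T, H w y := by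
    intro y hy
    rw [intervalIntegral.integral_of_le hy.2, ← integral_Icc_eq_integral_Ioc]
    have : ∀ w, H w y = (Ici y).indicator (fun w => h w y) w := fun w => by
      by_cases hw : y ≤ w <;> simp [hH, hw]
    simp only [this]
    rw [setIntegral_indicator measurableSet_Ici]
    congr 2
    ext w
    constructor
    · exact fun hw => ⟨⟨hy.1.trans_le hw.1, hw.2⟩, hw.1⟩
    · exact fun hw => ⟨hw.2, hw.1.2⟩
  rw [intervalIntegral.integral_of_le hT, intervalIntegral.integral_of_le hT,
    setIntegral_congr_fun measurableSet_Ioc e1, setIntegral_congr_fun measurableSet_Ioc e2]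
  exact integral_integral_swap hint

/-! ### The two-time energy and its integration along characteristics. -/

namespace IsWaveKernel

variable {p q : ℝ → ℝ} {k : ℝ → ℝ → ℝ} {f g : ℝ → ℝ}

/-- The weighted inner product of two waves at two times. -/
noncomputable def energy (p : ℝ → ℝ) (k : ℝ → ℝ → ℝ) (f g : ℝ → ℝ) (s t : ℝ) : ℝ :=
  ∫ x, p x * (conv k f x s * conv k g x t)

theorem contDiff_deriv (hf : ContDiff ℝ ∞ f) : ContDiff ℝ ∞ (deriv f) :=
  (contDiff_infty_iff_deriv.1 hf).2

/-- The energy differentiated along a line in the plane of the two times. -/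
theorem hasDerivAt_energy (hk : IsWaveKernel p q k) (hf : ContDiff ℝ ∞ f)
    (hfc : HasCompactSupport f) (hg : ContDiff ℝ ∞ g) (hgc : HasCompactSupport g)
    (s t α β z₀ : ℝ) :
    HasDerivAt (fun z => energy p k f g (s + α * z) (t + β * z))
      (α * energy p k (deriv f) g (s + α * z₀) (t + β * z₀)
        + β * energy p k f (deriv g) (s + α * z₀) (t + β * z₀)) z₀ := by
  have hf' := contDiff_deriv hf
  have hg' := contDiff_deriv hg
  obtain ⟨N, hN⟩ : ∃ N : ℝ, ∀ z ∈ Metric.ball z₀ 1, s + α * z ≤ N ∧ t + β * z ≤ N := by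
    have hcont : Continuous fun z => max (s + α * z) (t + β * z) := by fun_prop
    obtain ⟨N, hN⟩ := ((isCompact_closedBall z₀ 1).image hcont).bddAbove
    refine ⟨N, fun z hz => ?_⟩
    have := hN ⟨z, Metric.ball_subset_closedBall hz, rfl⟩
    exact ⟨(le_max_left _ _).trans this, (le_max_right _ _).trans this⟩
  obtain ⟨C₁, L₁, hC₁, hL₁, b₁⟩ := hk.conv_bound hf.continuous hfc N
  obtain ⟨C₂, L₂, hC₂, hL₂, b₂⟩ := hk.conv_bound hf'.continuous hfc.deriv N
  obtain ⟨C₃, L₃, hC₃, hL₃, b₃⟩ := hk.conv_bound hg.continuous hgc N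
  obtain ⟨C₄, L₄, hC₄, hL₄, b₄⟩ := hk.conv_bound hg'.continuous hgc.deriv N
  -- The factors coming from f and f' confine the integrand; those coming from g and g' need only be
  -- bounded.
  set L := max L₁ L₂ with hL
  have key := hasDerivAt_integral_of_dominated_loc_of_deriv_le (μ := (volume : Measure ℝ))
    (𝕜 := ℝ) (x₀ := z₀)
    (F := fun z x => p x * (conv k f x (s + α * z) * conv k g x (t + β * z)))
    (F' := fun z x => p x * (α * conv k (deriv f) x (s + α * z) * conv k g x (t + β * z)
      + conv k f x (s + α * z) * (β * conv k (deriv g) x (t + β * z))))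
    (bound := (Icc 0 L).indicator fun x => |p x| * (|α| * C₂ * C₃ + C₁ * (|β| * C₄)))
    (Metric.ball_mem_nhds z₀ one_pos) ?_ ?_ ?_ ?_ ?_ ?_
  · refine key.2.congr_deriv ?_
    have i1 := hk.integrable_density_mul hf'.continuous hfc.deriv hg.continuous hgc
      (s + α * z₀) (t + β * z₀)
    have i2 := hk.integrable_density_mul hf.continuous hfc hg'.continuous hgc.deriv
      (s + α * z₀) (t + β * z₀)
    simp only [energy]
    rw [← integral_const_mul, ← integral_const_mul, ← integral_add (i1.const_mul α) (i2.const_mul β)]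
    refine integral_congr_ae (ae_of_all _ fun x => ?_)
    simp only
    ring
  · exact Eventually.of_forall fun z => (hk.integrable_density_mul hf.continuous hfc
      hg.continuous hgc _ _).aestronglyMeasurable
  · exact hk.integrable_density_mul hf.continuous hfc hg.continuous hgc _ _
  · have m1 := hk.measurable_conv hf.continuous (s + α * z₀)
    have m2 := hk.measurable_conv hf'.continuous (s + α * z₀)
    have m3 := hk.measurable_conv hg.continuous (t + β * z₀)
    have m4 := hk.measurable_conv hg'.continuous (t + β * z₀)
    have m5 := hk.continuous_density.measurable
    exact (by fun_prop : Measurable _).aestronglyMeasurable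
  · refine ae_of_all _ fun x z hz => ?_
    have h1 := b₁ x _ (hN z hz).1
    have h2 := b₂ x _ (hN z hz).1
    have h3 := (b₃ x _ (hN z hz).2).trans (indicator_le_self' (fun _ _ => hC₃) _)
    have h4 := (b₄ x _ (hN z hz).2).trans (indicator_le_self' (fun _ _ => hC₄) _)
    by_cases hx : x ∈ Icc 0 L
    · have h1 := h1.trans (indicator_le_self' (fun _ _ => hC₁) _)
      have h2 := h2.trans (indicator_le_self' (fun _ _ => hC₂) _)
      rw [indicator_of_mem hx, Real.norm_eq_abs, abs_mul]
      refine mul_le_mul_of_nonneg_left ((abs_add_le _ _).trans ?_) (abs_nonneg _)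
      rw [abs_mul, abs_mul, abs_mul, abs_mul]
      gcongr
    · have n1 : x ∉ Icc 0 L₁ := fun h => hx ⟨h.1, h.2.trans (le_max_left _ _)⟩
      have n2 : x ∉ Icc 0 L₂ := fun h => hx ⟨h.1, h.2.trans (le_max_right _ _)⟩
      rw [indicator_of_notMem n1] at h1
      rw [indicator_of_notMem n2] at h2
      rw [indicator_of_notMem hx, abs_eq_zero.1 (le_antisymm h1 (abs_nonneg _)),
        abs_eq_zero.1 (le_antisymm h2 (abs_nonneg _))]
      simp
  · exact ((hk.continuous_density.abs.mul
      continuous_const).continuousOn.integrableOn_Icc).integrable_indicator measurableSet_Icc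
  · refine ae_of_all _ fun x z _ => ?_
    have d1 : HasDerivAt (fun z => s + α * z) α z := by
      simpa using ((hasDerivAt_id z).const_mul α).const_add s
    have d2 : HasDerivAt (fun z => t + β * z) β z := by
      simpa using ((hasDerivAt_id z).const_mul β).const_add t
    have e1 := (hk.hasDerivAt_conv hf hfc x (s + α * z)).comp z d1
    have e2 := (hk.hasDerivAt_conv hg hgc x (t + β * z)).comp z d2
    refine ((e1.mul e2).const_mul (p x)).congr_deriv ?_
    simp only [Function.comp]
    ring

/-- The wave of a control, extended oddly in time. -/
noncomputable def oddConv (k : ℝ → ℝ → ℝ) (f : ℝ → ℝ) (x s : ℝ) : ℝ :=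
  conv k f x s - conv k (fun t => f (-t)) x (-s)

/-- The weighted inner product of an oddly extended wave with a wave. -/
noncomputable def oddEnergy (p : ℝ → ℝ) (k : ℝ → ℝ → ℝ) (f g : ℝ → ℝ) (s t : ℝ) : ℝ :=
  energy p k f g s t - energy p k (fun t => f (-t)) g (-s) t

theorem hasCompactSupport_comp_neg (hf : HasCompactSupport f) :
    HasCompactSupport fun t => f (-t) :=
  hf.comp_homeomorph (Homeomorph.neg ℝ)

theorem energy_neg_left (p : ℝ → ℝ) (k : ℝ → ℝ → ℝ) (f g : ℝ → ℝ) (s t : ℝ) :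
    energy p k (fun t => - f t) g s t = - energy p k f g s t := by
  simp [energy, conv, integral_neg]

theorem deriv_comp_neg_fun (f : ℝ → ℝ) : deriv (fun t => f (-t)) = fun t => - deriv f (-t) :=
  funext fun t => deriv_comp_neg f t

/-- In the advanced part the reversed time gives one sign and the derivative of f(−t) another; they
cancel, so differentiation in s again just replaces f by f'. -/
theorem hasDerivAt_oddEnergy (hk : IsWaveKernel p q k) (hf : ContDiff ℝ ∞ f)
    (hfc : HasCompactSupport f) (hg : ContDiff ℝ ∞ g) (hgc : HasCompactSupport g)
    (s t α β z₀ : ℝ) :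
    HasDerivAt (fun z => oddEnergy p k f g (s + α * z) (t + β * z))
      (α * oddEnergy p k (deriv f) g (s + α * z₀) (t + β * z₀)
        + β * oddEnergy p k f (deriv g) (s + α * z₀) (t + β * z₀)) z₀ := by
  have h1 := hk.hasDerivAt_energy hf hfc hg hgc s t α β z₀
  have h2 := hk.hasDerivAt_energy (hf.comp contDiff_neg) (hasCompactSupport_comp_neg hfc) hg hgc
    (-s) t (-α) β z₀
  have e : ∀ z, -s + -α * z = -(s + α * z) := fun z => by ring
  simp only [e, Function.comp_def, deriv_comp_neg_fun, energy_neg_left] at h2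
  refine (h1.sub h2).congr_deriv ?_
  simp only [oddEnergy]
  ring

/-- The second wave in `oddConv` is the advanced wave of f. It has the same Neumann datum f(s) as
the retarded one, so the difference has datum zero and contributes no term with the trace of the
g-wave. -/
theorem green_odd (hk : IsWaveKernel p q k) (hf : ContDiff ℝ ∞ f) (hfc : HasCompactSupport f)
    (hg : ContDiff ℝ ∞ g) (hgc : HasCompactSupport g) (s t : ℝ) :
    oddEnergy p k (deriv (deriv f)) g s t - oddEnergy p k f (deriv (deriv g)) s t
      = oddConv k f 0 s * g t := by
  have h1 := hk.green hf hfc hg hgc s t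
  have h2 := hk.green (hf.comp contDiff_neg) (hasCompactSupport_comp_neg hfc) hg hgc (-s) t
  have e : deriv (deriv fun t => f (-t)) = fun t => deriv (deriv f) (-t) := by
    rw [deriv_comp_neg_fun, deriv.fun_neg', deriv_comp_neg_fun]
    simp
  simp only [Function.comp_def, e, neg_neg] at h2
  simp only [oddEnergy, energy, oddConv]
  linarith

theorem continuous_oddConv (hk : IsWaveKernel p q k) (hf : ContDiff ℝ ∞ f)
    (hfc : HasCompactSupport f) (x : ℝ) : Continuous (oddConv k f x) := by
  have hc : ∀ g, ContDiff ℝ ∞ g → HasCompactSupport g → Continuous fun z => conv k g x z :=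
    fun g hg hgc => continuous_iff_continuousAt.2 fun z => (hk.hasDerivAt_conv hg hgc x z).continuousAt
  exact (hc f hf hfc).sub ((hc _ (hf.comp contDiff_neg) (hasCompactSupport_comp_neg hfc)).comp
    continuous_neg)

theorem oddEnergy_eq_zero (hk : IsWaveKernel p q k) {t : ℝ} (hg : ∀ s ≤ t, g s = 0) (s : ℝ) :
    oddEnergy p k f g s t = 0 := by
  simp [oddEnergy, energy, hk.conv_eq_zero_of_control hg]

/-- The sum of the two time derivatives of the energy, found by integration along the
characteristics of the second family. -/
theorem oddEnergy_deriv_add (hk : IsWaveKernel p q k) (hf : ContDiff ℝ ∞ f)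
    (hfc : HasCompactSupport f) (hg : ContDiff ℝ ∞ g) (hgc : HasCompactSupport g)
    (hg0 : tsupport g ⊆ Ioi 0) (s t : ℝ) :
    oddEnergy p k (deriv f) g s t + oddEnergy p k f (deriv g) s t
      = - ∫ y in (0 : ℝ)..t, oddConv k f 0 (s + t - y) * g y := by
  have hf' := contDiff_deriv hf
  have hg' := contDiff_deriv hg
  -- Along (s + t − z, z) the derivative of E_s + E_t is −(E_ss − E_tt), the mixed derivatives
  -- cancelling. The line starts at second time 0, where the g-wave vanishes.
  have hd : ∀ z : ℝ, HasDerivAt (fun z => oddEnergy p k (deriv f) g (s + t + -1 * z) (0 + 1 * z)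
      + oddEnergy p k f (deriv g) (s + t + -1 * z) (0 + 1 * z))
      (- (oddConv k f 0 (s + t - z) * g z)) z := by
    intro z
    refine ((hk.hasDerivAt_oddEnergy hf' hfc.deriv hg hgc (s + t) 0 (-1) 1 z).add
      (hk.hasDerivAt_oddEnergy hf hfc hg' hgc.deriv (s + t) 0 (-1) 1 z)).congr_deriv ?_
    have := hk.green_odd hf hfc hg hgc (s + t + -1 * z) (0 + 1 * z)
    have e1 : s + t - z = s + t + -1 * z := by ring
    have e2 : g z = g (0 + 1 * z) := by ring_nf
    rw [e1, e2]
    linarith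
  have hvan : ∀ s ≤ 0, g s = 0 := fun s hs =>
    image_eq_zero_of_notMem_tsupport fun h => absurd (hg0 h) (not_lt.2 hs)
  have hvan' : ∀ s ≤ 0, deriv g s = 0 := fun s hs =>
    image_eq_zero_of_notMem_tsupport fun h =>
      absurd (hg0 (tsupport_deriv_subset (𝕜 := ℝ) h)) (not_lt.2 hs)
  have hc := hk.continuous_oddConv hf hfc 0
  have hgcont := hg.continuous
  have := intervalIntegral.integral_eq_sub_of_hasDerivAt (a := 0) (b := t) (fun z _ => hd z)
    (Continuous.intervalIntegrable (by fun_prop) _ _)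
  rw [intervalIntegral.integral_neg] at this
  rw [this]
  have e0 : (0 : ℝ) + 1 * 0 = 0 := by norm_num
  rw [e0, hk.oddEnergy_eq_zero hvan, hk.oddEnergy_eq_zero hvan']
  have e1 : s + t + -1 * t = s := by ring
  have e2 : 0 + 1 * t = t := by ring
  rw [e1, e2]
  ring

/-- The inner product of two waves at the same time, through the boundary values. -/
theorem energy_eq (hk : IsWaveKernel p q k) {T : ℝ} (hT : 0 ≤ T) (hf : ContDiff ℝ ∞ f)
    (hfc : HasCompactSupport f) (hf0 : tsupport f ⊆ Ioo 0 T) (hg : ContDiff ℝ ∞ g)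
    (hgc : HasCompactSupport g) (hg0 : tsupport g ⊆ Ioo 0 T) :
    energy p k f g T T
      = - ∫ y in (0 : ℝ)..T, (1 / 2 * ∫ η in y..(2 * T - y), oddConv k f 0 η) * g y := by
  have hgcont := hg.continuous
  have hc := hk.continuous_oddConv hf hfc 0
  have hvan : ∀ s ≤ 0, g s = 0 := fun s hs =>
    image_eq_zero_of_notMem_tsupport fun h => absurd (hg0 h).1 (not_lt.2 hs)
  -- At time T the advanced wave sees only values of f at times ≥ T, which are zero.
  have h1 : energy p k f g T T = oddEnergy p k f g T T := by
    have : energy p k (fun t => f (-t)) g (-T) T = 0 := by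
      have : ∀ s ≤ -T, f (-s) = 0 := fun s hs =>
        image_eq_zero_of_notMem_tsupport fun h => absurd (hf0 h).2 (not_lt.2 (by linarith))
      simp [energy, hk.conv_eq_zero_of_control this]
    rw [oddEnergy, this, sub_zero]
  -- On the diagonal s = t = w the derivative of E is exactly E_s + E_t.
  have hd : ∀ w : ℝ, HasDerivAt (fun z => oddEnergy p k f g (0 + 1 * z) (0 + 1 * z))
      (- ∫ y in (0 : ℝ)..w, oddConv k f 0 (w + w - y) * g y) w := by
    intro w
    refine (hk.hasDerivAt_oddEnergy hf hfc hg hgc 0 0 1 1 w).congr_deriv ?_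
    have e : (0 : ℝ) + 1 * w = w := by ring
    rw [e, ← hk.oddEnergy_deriv_add hf hfc hg hgc (hg0.trans fun x hx => hx.1)]
    ring
  have hcont : Continuous (Function.uncurry fun w y => oddConv k f 0 (w + w - y) * g y) := by
    simp only [Function.uncurry_def]
    fun_prop
  have hcont' : Continuous fun w => ∫ y in (0 : ℝ)..w, oddConv k f 0 (w + w - y) * g y :=
    intervalIntegral.continuous_parametric_intervalIntegral_of_continuous hcont continuous_id
  have h2 := intervalIntegral.integral_eq_sub_of_hasDerivAt (a := 0) (b := T) (fun z _ => hd z)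
    (hcont'.neg.intervalIntegrable _ _)
  have e0 : (0 : ℝ) + 1 * 0 = 0 := by norm_num
  have e1 : (0 : ℝ) + 1 * T = T := by ring
  rw [e0, e1, hk.oddEnergy_eq_zero hvan, sub_zero, intervalIntegral.integral_neg,
    integral_integral_triangle hT <| (hcont.continuousOn.integrableOn_compact
      (isCompact_Icc.prod isCompact_Icc)).mono_set
      (prod_mono Ioc_subset_Icc_self Ioc_subset_Icc_self)] at h2
  rw [h1, ← h2]
  congr 1
  refine intervalIntegral.integral_congr fun y _ => ?_
  rw [intervalIntegral.integral_mul_const]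
  congr 1
  have e2 : ∀ w : ℝ, w + w - y = 2 * w - y := fun w => by ring
  simp only [e2]
  -- The substitution η = 2w − y is the source of the factor 1/2.
  rw [intervalIntegral.integral_comp_mul_sub (fun η => oddConv k f 0 η) two_ne_zero]
  have e3 : 2 * y - y = y := by ring
  rw [e3, smul_eq_mul]
  norm_num

/-- The time integral of the oddly extended boundary values of a wave as an integral operator
applied to the control. -/
theorem integral_oddConv (hk : IsWaveKernel p q k) {T y : ℝ} (hf : Continuous f)
    (hfc : HasCompactSupport f) (hf0 : tsupport f ⊆ Ioo 0 T) (hy : y ∈ Ioo 0 T) :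
    ∫ η in y..(2 * T - y), oddConv k f 0 η
      = ∫ s in (0 : ℝ)..T, (∫ η in |y - s|..(2 * T - y - s), k 0 η) * f s := by
  have hT : 0 < T := hy.1.trans hy.2
  have hyT : y ≤ 2 * T - y := by linarith [hy.2]
  have hvan : ∀ s ∉ Ioo 0 T, f s = 0 := fun s hs =>
    image_eq_zero_of_notMem_tsupport fun h => hs (hf0 h)
  -- κ is the odd extension of the boundary kernel: retarded minus advanced becomes one convolution
  -- with κ.
  set κ : ℝ → ℝ := fun t => k 0 t - k 0 (-t) with hκ
  have hm0 : Measurable (k 0) := hk.measurable.comp measurable_prodMk_left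
  have hκm : Measurable κ := hm0.sub (hm0.comp measurable_neg)
  have h1 : ∀ η, oddConv k f 0 η = ∫ s, κ (η - s) * f s := by
    intro η
    have i1 := (hk.integrable_mul hf hfc 0 η).comp_sub_left η
    have i2 := (hk.integrable_mul (hf.comp continuous_neg) (hasCompactSupport_comp_neg hfc) 0
      (-η)).comp_sub_right η
    have e1 : conv k f 0 η = ∫ s, k 0 (η - s) * f s := by
      rw [conv, ← integral_sub_left_eq_self (fun t => k 0 t * f (η - t)) volume η]
      simp
    have e2 : conv k (fun t => f (-t)) 0 (-η) = ∫ s, k 0 (s - η) * f s := by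
      rw [conv, ← integral_sub_right_eq_self (fun t => k 0 t * f (-(-η - t))) η]
      simp
    have e3 : ∀ s, -(-η - (s - η)) = s := fun s => by ring
    simp only [sub_sub_cancel] at i1
    simp only [Function.comp_def, e3] at i2
    rw [oddConv, e1, e2, ← integral_sub i1 i2]
    refine integral_congr_ae (ae_of_all _ fun s => ?_)
    simp only [hκ, neg_sub]
    ring
  obtain ⟨C, L, hC, hL, hb⟩ := hk.bound (2 * T)
  have hint : Integrable (Function.uncurry fun η s => κ (η - s) * f s)
      ((volume.restrict (Ioc y (2 * T - y))).prod volume) := by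
    have hdom : Integrable (fun z : ℝ × ℝ => (2 * C) * |f z.2|)
        ((volume.restrict (Ioc y (2 * T - y))).prod volume) := by
      have := (integrable_const (μ := volume.restrict (Ioc y (2 * T - y))) (2 * C)).mul_prod
        (hf.integrable_of_hasCompactSupport (μ := (volume : Measure ℝ)) hfc).abs
      exact this
    refine hdom.mono' ?_ ?_
    · exact (Measurable.mul (hκm.comp (measurable_fst.sub measurable_snd))
        (hf.measurable.comp measurable_snd)).aestronglyMeasurable
    · have hae : ∀ᵐ z : ℝ × ℝ ∂((volume.restrict (Ioc y (2 * T - y))).prod volume),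
          z.1 ∈ Ioc y (2 * T - y) :=
        Measure.quasiMeasurePreserving_fst.ae (ae_restrict_mem measurableSet_Ioc)
      filter_upwards [hae] with z hz
      simp only [Function.uncurry_def, norm_mul, Real.norm_eq_abs]
      by_cases hs : z.2 ∈ Ioo 0 T
      · refine mul_le_mul_of_nonneg_right ?_ (abs_nonneg _)
        have b1 := (hb 0 (z.1 - z.2) (by linarith [hz.2, hs.1, hy.1])).trans
          (indicator_le_self' (fun _ _ => hC) _)
        have b2 := (hb 0 (-(z.1 - z.2)) (by linarith [hz.1, hs.2, hy.1])).trans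
          (indicator_le_self' (fun _ _ => hC) _)
        exact (abs_sub _ _).trans (by linarith)
      · simp [hvan _ hs]
  rw [intervalIntegral.integral_of_le hyT]
  simp only [h1]
  rw [integral_integral_swap hint, intervalIntegral.integral_of_le hT.le]
  rw [← setIntegral_eq_integral_of_forall_compl_eq_zero (s := Ioc 0 T)]
  swap
  · intro s hs
    simp [hvan s fun h => hs ⟨h.1, h.2.le⟩]
  refine setIntegral_congr_fun measurableSet_Ioc fun s hs => ?_
  rw [integral_mul_const, ← intervalIntegral.integral_of_le hyT,
    intervalIntegral.integral_comp_sub_right]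
  congr 1
  have hii0 : ∀ a b : ℝ, IntervalIntegrable (k 0) volume a b := fun a b =>
    ((hk.locallyIntegrable 0).integrableOn_isCompact isCompact_uIcc).intervalIntegrable
  have hii : ∀ a b : ℝ, IntervalIntegrable κ volume a b := fun a b =>
    (hii0 a b).sub (by simpa using (hii0 (-a) (-b)).comp_sub_left 0)
  -- The interval is degenerate or symmetric about 0, and κ is odd; this is how |y − s| enters the
  -- kernel.
  have hodd : ∫ η in (y - s)..|y - s|, κ η = 0 := by
    rcases abs_cases (y - s) with ⟨h, -⟩ | ⟨h, -⟩
    · rw [h]; simp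
    · rw [h]
      have e : ∫ η in (y - s)..(-(y - s)), κ η = ∫ η in (y - s)..(-(y - s)), κ (-η) := by
        rw [intervalIntegral.integral_comp_neg]
        simp
      have e' : ∀ η, κ (-η) = - κ η := fun η => by simp [hκ]
      simp only [e', intervalIntegral.integral_neg] at e
      linarith
  rw [← intervalIntegral.integral_add_adjacent_intervals (hii (y - s) |y - s|) (hii |y - s| _),
    hodd, zero_add]
  have hle : |y - s| ≤ 2 * T - y - s := abs_le.2 ⟨by linarith [hy.2, hs.2], by linarith [hs.2, hy.2]⟩
  rw [intervalIntegral.integral_of_le hle, intervalIntegral.integral_of_le hle]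
  refine setIntegral_congr_fun measurableSet_Ioc fun η hη => ?_
  simp only [hκ]
  rw [hk.eq_zero 0 (-η) (by linarith [hη.1, abs_nonneg (y - s)]), sub_zero]

end IsWaveKernel

/-! ### The eikonal, and the fundamental solution as a wave kernel. -/

/-- The closed sector above the wave front. -/
def sector (ρ : ℝ → ℝ) : Set (ℝ × ℝ) := {y | 0 ≤ y.1 ∧ eikonal ρ y.1 ≤ y.2}

/-- The fundamental solution extended by zero outside its sector. -/
noncomputable def sectorKernel (ρ : ℝ → ℝ) (r : ℝ → ℝ → ℝ) (x t : ℝ) : ℝ :=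
  (sector ρ).indicator (fun y => r y.1 y.2) (x, t)

/-- A function on the closed half-line extended by its value at the end point. -/
def constExtend (ρ : ℝ → ℝ) (x : ℝ) : ℝ := ρ (max x 0)

variable {ρ q : ℝ → ℝ} {r : ℝ → ℝ → ℝ}

theorem constExtend_of_nonneg (ρ : ℝ → ℝ) {x : ℝ} (hx : 0 ≤ x) : constExtend ρ x = ρ x := by
  rw [constExtend, max_eq_left hx]

theorem continuous_constExtend (h : ContinuousOn ρ (Ici 0)) : Continuous (constExtend ρ) :=
  h.comp_continuous (continuous_id.max continuous_const) fun _ => mem_Ici.2 (le_max_right _ _)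

/-- Nothing is known about ρ on the negative axis; the extension supplies global continuity without
changing the eikonal where it matters. -/
theorem eikonal_constExtend (ρ : ℝ → ℝ) {x : ℝ} (hx : 0 ≤ x) :
    eikonal (constExtend ρ) x = eikonal ρ x := by
  refine intervalIntegral.integral_congr fun s hs => ?_
  rw [uIcc_of_le hx] at hs
  simp only [constExtend_of_nonneg ρ hs.1]

theorem continuous_eikonal (h : Continuous ρ) : Continuous (eikonal ρ) :=
  intervalIntegral.continuous_primitive
    (fun a b => (Real.continuous_sqrt.comp h).intervalIntegrable a b) 0

theorem eikonal_zero (ρ : ℝ → ℝ) : eikonal ρ 0 = 0 := by simp [eikonal]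

namespace IsAdmissible

theorem continuous_density (h : IsAdmissible ρ q) : Continuous (constExtend ρ) :=
  continuous_constExtend h.smooth_density.continuousOn

theorem continuousOn_eikonal (h : IsAdmissible ρ q) : ContinuousOn (eikonal ρ) (Ici 0) :=
  (continuous_eikonal h.continuous_density).continuousOn.congr fun _ hx =>
    (eikonal_constExtend ρ hx).symm

theorem strictMonoOn_eikonal (h : IsAdmissible ρ q) : StrictMonoOn (eikonal ρ) (Ici 0) := by
  intro x hx y hy hxy
  rw [← eikonal_constExtend ρ hx, ← eikonal_constExtend ρ hy]
  have hc : Continuous fun s => √(constExtend ρ s) := Real.continuous_sqrt.comp h.continuous_density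
  have h1 : 0 < ∫ s in x..y, √(constExtend ρ s) :=
    intervalIntegral.intervalIntegral_pos_of_pos (hc.intervalIntegrable _ _)
      (fun s => Real.sqrt_pos.2 (h.density_pos _ (le_max_right _ _))) hxy
  have h2 := intervalIntegral.integral_add_adjacent_intervals (hc.intervalIntegrable 0 x)
    (hc.intervalIntegrable x y) (μ := volume)
  simp only [eikonal]
  linarith

theorem eikonal_nonneg (h : IsAdmissible ρ q) {x : ℝ} (hx : 0 ≤ x) : 0 ≤ eikonal ρ x := by
  rw [← eikonal_zero ρ]
  exact h.strictMonoOn_eikonal.monotoneOn (mem_Ici.2 le_rfl) hx hx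

theorem isClosed_sector (h : IsAdmissible ρ q) : IsClosed (sector ρ) := by
  have : sector ρ = {y : ℝ × ℝ | 0 ≤ y.1} ∩ {y | eikonal (constExtend ρ) y.1 ≤ y.2} := by
    ext y
    simp only [sector, mem_ofPred_eq, mem_inter_iff]
    exact and_congr_right fun hy => by rw [eikonal_constExtend ρ hy]
  rw [this]
  exact (isClosed_le continuous_const continuous_fst).inter
    (isClosed_le ((continuous_eikonal h.continuous_density).comp continuous_fst) continuous_snd)

theorem surjOn_eikonal (h : IsAdmissible ρ q) : SurjOn (eikonal ρ) (Ici 0) (Ici 0) := by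
  intro t ht
  obtain ⟨b, hb, hb0⟩ := ((h.eikonal_tendsto.eventually_ge_atTop t).and
    (eventually_ge_atTop 0)).exists
  obtain ⟨x, hx, hxt⟩ := intermediate_value_Icc hb0 (h.continuousOn_eikonal.mono Icc_subset_Ici_self)
    (show t ∈ Icc (eikonal ρ 0) (eikonal ρ b) from ⟨by rwa [eikonal_zero], hb⟩)
  exact ⟨x, hx.1, hxt⟩

theorem frontPoint_nonneg (h : IsAdmissible ρ q) {t : ℝ} (ht : 0 ≤ t) : 0 ≤ frontPoint ρ t :=
  Function.invFunOn_mem (h.surjOn_eikonal ht)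

theorem eikonal_frontPoint (h : IsAdmissible ρ q) {t : ℝ} (ht : 0 ≤ t) :
    eikonal ρ (frontPoint ρ t) = t :=
  Function.invFunOn_eq (h.surjOn_eikonal ht)

end IsAdmissible

theorem sectorKernel_of_mem {x t : ℝ} (h : (x, t) ∈ sector ρ) : sectorKernel ρ r x t = r x t := by
  simp [sectorKernel, h]

theorem sectorKernel_of_notMem {x t : ℝ} (h : (x, t) ∉ sector ρ) : sectorKernel ρ r x t = 0 := by
  simp [sectorKernel, h]

theorem sectorKernel_zero_left {t : ℝ} (ht : 0 ≤ t) : sectorKernel ρ r 0 t = r 0 t :=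
  sectorKernel_of_mem ⟨le_rfl, by simpa [eikonal_zero] using ht⟩

namespace IsFundamentalSolution

theorem isWaveKernel (hρq : IsAdmissible ρ q) (hr : IsFundamentalSolution ρ q r) :
    IsWaveKernel (constExtend ρ) (constExtend q) (sectorKernel ρ r) where
  continuous_density := hρq.continuous_density
  continuous_potential := continuous_constExtend hρq.smooth_potential.continuousOn
  measurable := by
    classical
    have : Function.uncurry (sectorKernel ρ r)
        = (sector ρ).piecewise (fun y => r y.1 y.2) fun _ => 0 := by
      exact (piecewise_eq_indicator (s := sector ρ)).symm
    rw [this]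
    exact ContinuousOn.measurable_piecewise (s := sector ρ) hr.smooth.continuousOn
      continuousOn_const
      hρq.isClosed_sector.measurableSet
  bound := by
    intro M
    have hL := hρq.frontPoint_nonneg (le_max_right M 0)
    -- The maximum with 0 is needed because `frontPoint` inverts the eikonal only at nonnegative
    -- times.
    set L := frontPoint ρ (max M 0) with hLdef
    have hin : ∀ x t, t ≤ M → (x, t) ∈ sector ρ → x ∈ Icc 0 L ∧ t ∈ Icc 0 M := by
      intro x t ht hxt
      refine ⟨⟨hxt.1, ?_⟩, (hρq.eikonal_nonneg hxt.1).trans hxt.2, ht⟩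
      refine (hρq.strictMonoOn_eikonal.le_iff_le hxt.1 hL).1 ?_
      rw [hLdef, hρq.eikonal_frontPoint (le_max_right M 0)]
      exact hxt.2.trans (ht.trans (le_max_left _ _))
    have hK : IsCompact (sector ρ ∩ Icc 0 L ×ˢ Icc 0 M) :=
      (isCompact_Icc.prod isCompact_Icc).inter_left hρq.isClosed_sector
    obtain ⟨C, hC⟩ := hK.exists_bound_of_continuousOn (hr.smooth.continuousOn.mono inter_subset_left)
    refine ⟨max C 0, L, le_max_right _ _, hL, fun x t ht => ?_⟩
    by_cases hxt : (x, t) ∈ sector ρ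
    · have h1 := hin x t ht hxt
      rw [sectorKernel_of_mem hxt, indicator_of_mem h1.1]
      exact (hC (x, t) ⟨hxt, h1⟩).trans (le_max_left _ _)
    · rw [sectorKernel_of_notMem hxt, abs_zero]
      exact indicator_nonneg (fun _ _ => le_max_right _ _) _
  eq_zero := fun x t ht => sectorKernel_of_notMem fun h =>
    absurd ((hρq.eikonal_nonneg h.1).trans h.2) (not_le.2 ht)
  continuousWithinAt := by
    intro x₀ hx₀
    -- Off the front, (x₀, t) either lies strictly below it, where the kernel is zero nearby, or
    -- strictly above, where r is smooth up to x = 0.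
    have h1 : ∀ᵐ t : ℝ, t ≠ eikonal ρ x₀ := by simp [ae_iff]
    filter_upwards [h1] with t ht
    have hc := hρq.continuousOn_eikonal x₀ hx₀
    rcases lt_or_gt_of_ne ht with h | h
    · refine (continuousWithinAt_const (b := (0 : ℝ))).congr_of_eventuallyEq ?_ ?_
      · filter_upwards [hc (Ioi_mem_nhds h)] with x hx
        exact sectorKernel_of_notMem fun h' => absurd h'.2 (not_le.2 hx)
      · exact sectorKernel_of_notMem fun h' => absurd h'.2 (not_le.2 h)
    · have hr0 : ContinuousWithinAt (fun x => r x t) {x | (x, t) ∈ sector ρ} x₀ :=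
        (hr.smooth.continuousOn (x₀, t) ⟨hx₀, h.le⟩).comp (t := sector ρ)
          (f := fun x => (x, t)) (by fun_prop) fun x hx => hx
      have hmem : {x | (x, t) ∈ sector ρ} ∈ 𝓝[Ici 0] x₀ := by
        filter_upwards [hc (Iio_mem_nhds h), self_mem_nhdsWithin] with x hx hx0
          using ⟨hx0, le_of_lt hx⟩
      refine (hr0.mono_of_mem_nhdsWithin hmem).congr_of_eventuallyEq ?_ ?_
      · filter_upwards [hmem] with x hx using sectorKernel_of_mem hx
      · exact sectorKernel_of_mem ⟨hx₀, h.le⟩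
  weak := by
    intro X Θ hX hXc hX0 hΘ hΘc
    have hφ : ContDiff ℝ ∞ fun y : ℝ × ℝ => X y.1 * Θ y.2 :=
      (hX.comp contDiff_fst).mul (hΘ.comp contDiff_snd)
    have hφc : HasCompactSupport fun y : ℝ × ℝ => X y.1 * Θ y.2 := by
      refine HasCompactSupport.intro (hXc.isCompact.prod hΘc.isCompact) ?_
      rintro ⟨x, t⟩ hxt
      rw [mem_prod, not_and_or] at hxt
      rcases hxt with h | h
      · simp [image_eq_zero_of_notMem_tsupport h]
      · simp [image_eq_zero_of_notMem_tsupport h]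
    have h := hr.equation (fun x t => X x * Θ t) hφ hφc fun t => by simp [hX0]
    -- The extended kernel vanishes for x < 0 and the line x = 0 is null, so the half-plane integral
    -- equals the one over the plane.
    rw [← h, ← integral_indicator (measurableSet_lt measurable_const measurable_fst)]
    refine integral_congr_ae ?_
    have h1 : ∀ᵐ x : ℝ, x ≠ 0 := by simp [ae_iff]
    have h2 : ∀ᵐ y : ℝ × ℝ, y.1 ≠ 0 := Measure.quasiMeasurePreserving_fst.ae h1
    filter_upwards [h2] with y hy
    rcases lt_or_gt_of_ne hy with hneg | hpos
    · rw [indicator_of_notMem (by simpa using hneg.le),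
        sectorKernel_of_notMem fun h' => absurd h'.1 (not_le.2 hneg), zero_mul]
    · rw [indicator_of_mem (by simpa using hpos), constExtend_of_nonneg ρ hpos.le,
        constExtend_of_nonneg q hpos.le]
      have d1 : iteratedDeriv 2 (fun t => X y.1 * Θ t) y.2 = X y.1 * deriv (deriv Θ) y.2 := by
        rw [iteratedDeriv_succ, iteratedDeriv_one]
        simp
      have d2 : iteratedDeriv 2 (fun x => X x * Θ y.2) y.1 = deriv (deriv X) y.1 * Θ y.2 := by
        rw [iteratedDeriv_succ, iteratedDeriv_one]
        simp
      rw [d1, d2]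
      by_cases hs : (y.1, y.2) ∈ sector ρ
      · rw [sectorKernel_of_mem hs]
      · rw [sectorKernel_of_notMem hs, hr.eq_zero y.1 y.2 hpos.le (by
          by_contra h'
          exact hs ⟨hpos.le, not_lt.1 h'⟩)]

end IsFundamentalSolution

/-! ### Bounded integral operators between L₂ spaces. -/

section IntegralOperator

variable {α β : Type*} [MeasurableSpace α] [MeasurableSpace β] {μ : Measure α} {ν : Measure β}
  [IsFiniteMeasure μ] [IsFiniteMeasure ν]

theorem integral_norm_le_norm_Lp (f : Lp ℝ 2 μ) :
    ∫ a, ‖f a‖ ∂μ ≤ (μ univ ^ (1 / 2 : ℝ)).toReal * ‖f‖ := by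
  rw [integral_norm_eq_lintegral_enorm (Lp.aestronglyMeasurable f), ← eLpNorm_one_eq_lintegral_enorm,
    Lp.norm_def, mul_comm, ← ENNReal.toReal_mul]
  refine ENNReal.toReal_mono (ENNReal.mul_ne_top (Lp.eLpNorm_ne_top f) ?_) ?_
  · exact (ENNReal.rpow_lt_top_of_nonneg (by norm_num) (measure_ne_top _ _)).ne
  · refine (eLpNorm_le_eLpNorm_mul_rpow_measure_univ (q := 2) (by norm_num)
      (Lp.aestronglyMeasurable f)).trans (le_of_eq ?_)
    norm_num

/-- A bounded measurable kernel on a product of finite measure spaces defines a bounded operator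
between the spaces of square-integrable functions. -/
theorem exists_integralOperator {K : β → α → ℝ} (hK : Measurable (Function.uncurry K)) {M : ℝ}
    (hM : 0 ≤ M) (hb : ∀ᵐ b ∂ν, ∀ᵐ a ∂μ, |K b a| ≤ M) :
    ∃ A : Lp ℝ 2 μ →L[ℝ] Lp ℝ 2 ν, ∀ f : Lp ℝ 2 μ, ∀ᵐ b ∂ν, A f b = ∫ a, K b a * f a ∂μ := by
  have hfi : ∀ f : Lp ℝ 2 μ, Integrable f μ := fun f => (Lp.memLp f).integrable (by norm_num)
  have hint : ∀ f : Lp ℝ 2 μ, ∀ᵐ b ∂ν, Integrable (fun a => K b a * f a) μ := by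
    intro f
    filter_upwards [hb] with b hb
    refine (hfi f).bdd_mul (c := M) ?_ hb
    exact (hK.comp measurable_prodMk_left).aestronglyMeasurable
  have hbd : ∀ f : Lp ℝ 2 μ, ∀ᵐ b ∂ν, ‖∫ a, K b a * f a ∂μ‖ ≤ M * ∫ a, ‖f a‖ ∂μ := by
    intro f
    filter_upwards [hb] with b hb
    rw [← integral_const_mul]
    refine norm_integral_le_of_norm_le ((hfi f).norm.const_mul M) ?_
    filter_upwards [hb] with a ha
    rw [norm_mul]
    exact mul_le_mul_of_nonneg_right ha (norm_nonneg _)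
  have hmem : ∀ f : Lp ℝ 2 μ, MemLp (fun b => ∫ a, K b a * f a ∂μ) 2 ν := by
    intro f
    refine MemLp.of_bound ?_ _ (hbd f)
    have : StronglyMeasurable (Function.uncurry fun b a => K b a * f a) :=
      hK.stronglyMeasurable.mul ((Lp.stronglyMeasurable f).comp_measurable measurable_snd)
    exact this.integral_prod_right.aestronglyMeasurable
  let A₀ : Lp ℝ 2 μ →ₗ[ℝ] Lp ℝ 2 ν :=
    { toFun := fun f => (hmem f).toLp _
      map_add' := by
        intro f g
        rw [← MemLp.toLp_add]
        refine MemLp.toLp_congr _ _ ?_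
        filter_upwards [hint f, hint g] with b h1 h2
        rw [Pi.add_apply, ← integral_add h1 h2]
        refine integral_congr_ae ?_
        filter_upwards [Lp.coeFn_add f g] with a ha
        rw [ha, Pi.add_apply]
        ring
      map_smul' := by
        intro c f
        rw [RingHom.id_apply, ← MemLp.toLp_const_smul]
        refine MemLp.toLp_congr _ _ (ae_of_all _ fun b => ?_)
        rw [Pi.smul_apply, smul_eq_mul, ← integral_const_mul]
        refine integral_congr_ae ?_
        filter_upwards [Lp.coeFn_smul c f] with a ha
        rw [ha, Pi.smul_apply, smul_eq_mul]
        ring }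
  -- The norm bound is ν(β)^{1/2} · M · μ(α)^{1/2}: a uniform bound on the image, combined with
  -- Cauchy–Schwarz on the source.
  refine ⟨A₀.mkContinuous ((measureUnivNNReal ν : ℝ) ^ (ENNReal.toReal 2)⁻¹
    * (M * (μ univ ^ (1 / 2 : ℝ)).toReal)) ?_, fun f => MemLp.coeFn_toLp (hmem f)⟩
  intro f
  have h1 : ∀ᵐ b ∂ν, ‖A₀ f b‖ ≤ M * ∫ a, ‖f a‖ ∂μ := by
    filter_upwards [hbd f, MemLp.coeFn_toLp (hmem f)] with b h1 h2
    exact (congrArg norm h2).le.trans h1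
  have h2 := Lp.norm_le_of_ae_bound (p := 2)
    (mul_nonneg hM (integral_nonneg fun a => norm_nonneg (f a))) h1
  refine h2.trans ?_
  rw [mul_assoc, mul_assoc]
  gcongr
  exact integral_norm_le_norm_Lp f

end IntegralOperator

/-! ### Reflection about T and the odd extension operator. -/

theorem measurePreserving_sub_left_Ioo (a b c : ℝ) :
    MeasurePreserving (fun t => c - t) (volume.restrict (Ioo (c - b) (c - a)))
      (volume.restrict (Ioo a b)) := by
  have h := (Measure.measurePreserving_sub_left (volume : Measure ℝ) c).restrict_preimage
    (measurableSet_Ioo (a := a) (b := b))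
  rwa [preimage_const_sub_Ioo] at h

theorem measurePreserving_reflect (T : ℝ) :
    MeasurePreserving (fun t => 2 * T - t) (volume.restrict (Ioo T (2 * T)))
      (outerMeasure T) := by
  have h := measurePreserving_sub_left_Ioo 0 T (2 * T)
  rwa [two_mul, add_sub_cancel_right, sub_zero, ← two_mul] at h

theorem restrict_Iic_outerMeasure {T : ℝ} (hT : 0 < T) :
    (outerMeasure (2 * T)).restrict (Iic T) = outerMeasure T := by
  rw [Measure.restrict_restrict measurableSet_Iic]
  have : Iic T ∩ Ioo 0 (2 * T) = Ioc 0 T := by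
    ext t
    simp only [mem_inter_iff, mem_Iic, mem_Ioo, mem_Ioc]
    constructor
    · exact fun h => ⟨h.2.1, h.1⟩
    · exact fun h => ⟨h.2, h.1, by linarith [h.2]⟩
  rw [this]
  exact Measure.restrict_congr_set Ioo_ae_eq_Ioc.symm

theorem restrict_Ioi_outerMeasure {T : ℝ} (hT : 0 < T) :
    (outerMeasure (2 * T)).restrict (Ioi T) = volume.restrict (Ioo T (2 * T)) := by
  rw [Measure.restrict_restrict measurableSet_Ioi]
  congr 1
  ext t
  simp only [mem_inter_iff, mem_Ioi, mem_Ioo]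
  exact ⟨fun h => ⟨h.1, h.2.2⟩, fun h => ⟨h.1, hT.trans h.1, h.2⟩⟩

/-- A property that holds almost everywhere on `(0, 2T)` holds at almost every point of `(0, T)`
and at its reflection. -/
theorem ae_outerMeasure_two_mul {T : ℝ} (hT : 0 < T) {P : ℝ → Prop}
    (h : ∀ᵐ t ∂(outerMeasure (2 * T)), P t) :
    ∀ᵐ t ∂(outerMeasure T), P t ∧ P (2 * T - t) := by
  have h1 : ∀ᵐ t ∂(outerMeasure T), P t := by
    rw [← restrict_Iic_outerMeasure hT]
    exact ae_restrict_of_ae h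
  have h2 : ∀ᵐ t ∂(volume.restrict (Ioo T (2 * T))), P t := by
    rw [← restrict_Ioi_outerMeasure hT]
    exact ae_restrict_of_ae h
  have h3 : ∀ᵐ t ∂(outerMeasure T), P (2 * T - t) := by
    have h := measurePreserving_sub_left_Ioo T (2 * T) (2 * T)
    rw [sub_self, two_mul, add_sub_cancel_right, ← two_mul] at h
    exact h.quasiMeasurePreserving.ae h2
  filter_upwards [h1, h3] with t h1 h3 using ⟨h1, h3⟩

theorem exists_oddExtensionOperator {T : ℝ} (hT : 0 < T) :
    ∃ S : OuterSpace T →L[ℝ] OuterSpace (2 * T), IsOddExtensionOperator T S := by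
  -- Splitting by indicators lets each half be treated on its own interval, the second one through
  -- the measure-preserving reflection.
  set F : (ℝ → ℝ) → ℝ → ℝ := fun f =>
    (Iic T).indicator f + (Ioi T).indicator (fun t => - f (2 * T - t)) with hF
  have hFapp : ∀ f t, F f t = if t ≤ T then f t else - f (2 * T - t) := by
    intro f t
    by_cases h : t ≤ T
    · simp [hF, h]
    · simp [hF, h, not_le.1 h]
  have hm1 : ∀ f : OuterSpace T, MemLp ((Iic T).indicator f) 2 (outerMeasure (2 * T)) := by
    intro f
    rw [memLp_indicator_iff_restrict measurableSet_Iic, restrict_Iic_outerMeasure hT]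
    exact Lp.memLp f
  have hm2' : ∀ f : OuterSpace T, MemLp (fun t => - f (2 * T - t)) 2
      (volume.restrict (Ioo T (2 * T))) := fun f =>
    ((Lp.memLp f).comp_measurePreserving (measurePreserving_reflect T)).neg
  have hm2 : ∀ f : OuterSpace T, MemLp ((Ioi T).indicator fun t => - f (2 * T - t)) 2
      (outerMeasure (2 * T)) := by
    intro f
    rw [memLp_indicator_iff_restrict measurableSet_Ioi, restrict_Ioi_outerMeasure hT]
    exact hm2' f
  have hmem : ∀ f : OuterSpace T, MemLp (F f) 2 (outerMeasure (2 * T)) := fun f =>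
    (hm1 f).add (hm2 f)
  have hcongr : ∀ u v : ℝ → ℝ, u =ᵐ[outerMeasure T] v → F u =ᵐ[outerMeasure (2 * T)] F v := by
    intro u v huv
    have h1 : ∀ᵐ t ∂(outerMeasure (2 * T)), t ∈ Iic T → u t = v t := by
      rw [← ae_restrict_iff' measurableSet_Iic, restrict_Iic_outerMeasure hT]
      exact huv
    have h2 : ∀ᵐ t ∂(outerMeasure (2 * T)), t ∈ Ioi T → u (2 * T - t) = v (2 * T - t) := by
      rw [← ae_restrict_iff' measurableSet_Ioi, restrict_Ioi_outerMeasure hT]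
      exact (measurePreserving_reflect T).quasiMeasurePreserving.ae huv
    filter_upwards [h1, h2] with t h1 h2
    rw [hFapp, hFapp]
    split_ifs with h
    · exact h1 h
    · rw [h2 (not_le.1 h)]
  let S₀ : OuterSpace T →ₗ[ℝ] OuterSpace (2 * T) :=
    { toFun := fun f => (hmem f).toLp _
      map_add' := by
        intro f g
        rw [← MemLp.toLp_add]
        refine MemLp.toLp_congr _ _ ((hcongr _ _ (Lp.coeFn_add f g)).trans (ae_of_all _ fun t => ?_))
        simp only [hFapp, Pi.add_apply]
        split_ifs
        · rfl
        · ring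
      map_smul' := by
        intro c f
        rw [RingHom.id_apply, ← MemLp.toLp_const_smul]
        refine MemLp.toLp_congr _ _ ((hcongr _ _ (Lp.coeFn_smul c f)).trans (ae_of_all _ fun t => ?_))
        simp only [hFapp, Pi.smul_apply, smul_eq_mul]
        split_ifs
        · rfl
        · ring }
  -- Each half has the norm of f, and the triangle inequality gives 2.
  refine ⟨S₀.mkContinuous 2 ?_, fun f => ?_⟩
  · intro f
    change ‖(hmem f).toLp _‖ ≤ 2 * ‖f‖
    rw [Lp.norm_toLp, Lp.norm_def]
    have e1 : eLpNorm ((Iic T).indicator f) 2 (outerMeasure (2 * T))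
        = eLpNorm f 2 (outerMeasure T) := by
      rw [eLpNorm_indicator_eq_eLpNorm_restrict measurableSet_Iic, restrict_Iic_outerMeasure hT]
    have e2 : eLpNorm ((Ioi T).indicator fun t => - f (2 * T - t)) 2 (outerMeasure (2 * T))
        = eLpNorm f 2 (outerMeasure T) := by
      rw [eLpNorm_indicator_eq_eLpNorm_restrict measurableSet_Ioi, restrict_Ioi_outerMeasure hT]
      exact (eLpNorm_neg _ _ _).trans (eLpNorm_comp_measurePreserving
        (Lp.aestronglyMeasurable f) (measurePreserving_reflect T))
    have h3 := eLpNorm_add_le (hm1 f).aestronglyMeasurable (hm2 f).aestronglyMeasurable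
      (p := 2) (by norm_num)
    rw [e1, e2, ← two_mul] at h3
    have h4 := ENNReal.toReal_mono (ENNReal.mul_ne_top (by norm_num) (Lp.eLpNorm_ne_top f)) h3
    rwa [ENNReal.toReal_mul, ENNReal.toReal_ofNat] at h4
  · filter_upwards [MemLp.coeFn_toLp (hmem f)] with t ht
    rw [← hFapp]
    exact ht

/-! ### Existence of the control, response and integration operators. -/

variable {T : ℝ}

theorem innerMeasure_eq_constExtend (ρ : ℝ → ℝ) (T : ℝ) :
    innerMeasure ρ T = (volume.restrict (Ioo 0 (frontPoint ρ T))).withDensity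
      (fun x => ENNReal.ofReal (constExtend ρ x)) := by
  refine withDensity_congr_ae ?_
  filter_upwards [ae_restrict_mem measurableSet_Ioo] with x hx
  rw [constExtend_of_nonneg ρ hx.1.le]

theorem IsAdmissible.isFiniteMeasure_innerMeasure (h : IsAdmissible ρ q) (T : ℝ) :
    IsFiniteMeasure (innerMeasure ρ T) := by
  rw [innerMeasure_eq_constExtend]
  refine isFiniteMeasure_withDensity_ofReal (Integrable.hasFiniteIntegral ?_)
  exact h.continuous_density.continuousOn.integrableOn_Icc.mono_set Ioo_subset_Icc_self

theorem ae_innerMeasure_mem (ρ : ℝ → ℝ) (T : ℝ) :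
    ∀ᵐ x ∂(innerMeasure ρ T), x ∈ Ioo 0 (frontPoint ρ T) :=
  (withDensity_absolutelyContinuous _ _).ae_le (ae_restrict_mem measurableSet_Ioo)

theorem ae_outerMeasure_mem (T : ℝ) : ∀ᵐ t ∂(outerMeasure T), t ∈ Ioo 0 T :=
  ae_restrict_mem measurableSet_Ioo

theorem integral_innerMeasure (h : IsAdmissible ρ q) (g : ℝ → ℝ) :
    ∫ x, g x ∂(innerMeasure ρ T)
      = ∫ x in Ioo 0 (frontPoint ρ T), constExtend ρ x * g x := by
  rw [innerMeasure_eq_constExtend, integral_withDensity_eq_integral_toReal_smul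
    (f := fun x => ENNReal.ofReal (constExtend ρ x))
    (ENNReal.measurable_ofReal.comp h.continuous_density.measurable)
    (ae_of_all _ fun _ => ENNReal.ofReal_lt_top)]
  refine integral_congr_ae (ae_of_all _ fun x => ?_)
  simp only
  have h0 : 0 ≤ constExtend ρ x := (h.density_pos _ (le_max_right x 0)).le
  rw [ENNReal.toReal_ofReal h0, smul_eq_mul]

/-- The wave is given by the zero extension of the fundamental solution. -/
theorem wave_eq_setIntegral (h : IsAdmissible ρ q) (r : ℝ → ℝ → ℝ) (f : ℝ → ℝ) {x t S : ℝ}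
    (hx : 0 ≤ x) (ht : t ≤ S) :
    wave ρ r f x t = ∫ s in Ioo 0 S, sectorKernel ρ r x (t - s) * f s := by
  have hτ := h.eikonal_nonneg hx
  rw [← integral_Ioc_eq_integral_Ioo, setIntegral_eq_of_subset_of_forall_sdiff_eq_zero
    (s := Ioc 0 (t - eikonal ρ x)) measurableSet_Ioc
    (Ioc_subset_Ioc_right (by linarith))]
  · refine setIntegral_congr_fun measurableSet_Ioc fun s hs => ?_
    have : (x, t - s) ∈ sector ρ := ⟨hx, by linarith [hs.2]⟩
    simp only [sectorKernel_of_mem this]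
  · intro s hs
    rw [sectorKernel_of_notMem, zero_mul]
    intro h'
    exact hs.2 ⟨hs.1.1, by linarith [h'.2]⟩

theorem exists_controlOperator (h : IsAdmissible ρ q) (hr : IsFundamentalSolution ρ q r) (T : ℝ) :
    ∃ W : OuterSpace T →L[ℝ] InnerSpace ρ T, IsControlOperator ρ r T W := by
  have hk := hr.isWaveKernel h
  obtain ⟨C, L, hC, -, hb⟩ := hk.bound T
  have := h.isFiniteMeasure_innerMeasure T
  obtain ⟨W, hW⟩ := exists_integralOperator (μ := outerMeasure T) (ν := innerMeasure ρ T)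
    (K := fun x s => sectorKernel ρ r x (T - s))
    (hk.measurable.comp (measurable_fst.prodMk (measurable_const.sub measurable_snd))) hC
    (ae_of_all _ fun x => by
      filter_upwards [ae_outerMeasure_mem T] with s hs
      exact (hb x (T - s) (by linarith [hs.1])).trans (indicator_le_self' (fun _ _ => hC) _))
  refine ⟨W, fun f => ?_⟩
  filter_upwards [hW f, ae_innerMeasure_mem ρ T] with x hx hxm
  rw [hx, wave_eq_setIntegral h r f hxm.1.le le_rfl]

theorem exists_extendedResponseOperator (h : IsAdmissible ρ q) (hr : IsFundamentalSolution ρ q r)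
    (T : ℝ) : ∃ R : OuterSpace (2 * T) →L[ℝ] OuterSpace (2 * T),
      IsExtendedResponseOperator ρ r T R := by
  have hk := hr.isWaveKernel h
  obtain ⟨C, L, hC, -, hb⟩ := hk.bound (2 * T)
  obtain ⟨R, hR⟩ := exists_integralOperator (μ := outerMeasure (2 * T)) (ν := outerMeasure (2 * T))
    (K := fun t s => sectorKernel ρ r 0 (t - s))
    (hk.measurable.comp (measurable_const.prodMk (measurable_fst.sub measurable_snd))) hC
    (by
      filter_upwards [ae_outerMeasure_mem (2 * T)] with t ht
      filter_upwards [ae_outerMeasure_mem (2 * T)] with s hs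
      exact (hb 0 (t - s) (by linarith [hs.1, ht.2])).trans
        (indicator_le_self' (fun _ _ => hC) _))
  refine ⟨R, fun f => ?_⟩
  filter_upwards [hR f, ae_outerMeasure_mem (2 * T)] with t ht htm
  rw [ht, wave_eq_setIntegral h r f le_rfl htm.2.le]

theorem exists_integrationOperator (T : ℝ) :
    ∃ J : OuterSpace (2 * T) →L[ℝ] OuterSpace (2 * T), IsIntegrationOperator T J := by
  have hms : MeasurableSet {y : ℝ × ℝ | y.2 ≤ y.1} := measurableSet_le measurable_snd measurable_fst
  obtain ⟨J, hJ⟩ := exists_integralOperator (μ := outerMeasure (2 * T)) (ν := outerMeasure (2 * T))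
    (K := fun t s => {y : ℝ × ℝ | y.2 ≤ y.1}.indicator (fun _ => (1 : ℝ)) (t, s))
    (measurable_const.indicator hms) zero_le_one
    (ae_of_all _ fun t => ae_of_all _ fun s => by
      rw [abs_of_nonneg (indicator_nonneg (fun _ _ => zero_le_one) _)]
      exact indicator_le_self' (fun _ _ => zero_le_one) _)
  refine ⟨J, fun f => ?_⟩
  filter_upwards [hJ f, ae_outerMeasure_mem (2 * T)] with t ht htm
  rw [ht, intervalIntegral.integral_of_le htm.1.le]
  have : ∀ s, {y : ℝ × ℝ | y.2 ≤ y.1}.indicator (fun _ => (1 : ℝ)) (t, s) * f s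
      = (Iic t).indicator f s := fun s => by
    by_cases hs : s ≤ t <;> simp [hs]
  simp only [this]
  rw [integral_indicator measurableSet_Iic, Measure.restrict_restrict measurableSet_Iic]
  congr 2
  ext s
  simp only [mem_inter_iff, mem_Iic, mem_Ioo, mem_Ioc]
  exact ⟨fun h => ⟨h.2.1, h.1⟩, fun h => ⟨h.2, h.1, h.2.trans_lt htm.2⟩⟩

/-! ### Reduction to test controls, and the kernel of the connecting operator. -/

theorem inner_outerSpace (u v : OuterSpace T) :
    inner ℝ u v = ∫ t in Ioo 0 T, u t * v t := by
  rw [L2.inner_def]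
  refine integral_congr_ae (ae_of_all _ fun t => ?_)
  simp [mul_comm]

theorem memLp_outerMeasure {φ : ℝ → ℝ} (hφ : Continuous φ) (hφc : HasCompactSupport φ) :
    MemLp φ 2 (outerMeasure T) :=
  hφ.memLp_of_hasCompactSupport hφc

/-- A control orthogonal to all test functions is zero. -/
theorem eq_zero_of_inner_test {u : OuterSpace T}
    (h : ∀ φ : ℝ → ℝ, ∀ hφ : ContDiff ℝ ∞ φ, ∀ hφc : HasCompactSupport φ, tsupport φ ⊆ Ioo 0 T →
      inner ℝ u ((memLp_outerMeasure hφ.continuous hφc).toLp φ) = 0) : u = 0 := by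
  have hint : IntegrableOn u (Ioo 0 T) := (Lp.memLp u).integrable (by norm_num)
  have key : ∀ᵐ t : ℝ, t ∈ Ioo 0 T → u t = 0 := by
    refine isOpen_Ioo.ae_eq_zero_of_integral_contDiff_smul_eq_zero (E := ℝ)
      hint.locallyIntegrableOn ?_
    intro g hg hgc hgs
    have h1 := h g hg hgc hgs
    rw [inner_outerSpace] at h1
    rw [← h1, ← setIntegral_eq_integral_of_forall_compl_eq_zero (s := Ioo 0 T)]
    · refine integral_congr_ae ?_
      filter_upwards [MemLp.coeFn_toLp (memLp_outerMeasure (T := T) hg.continuous hgc)] with t ht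
      rw [ht, smul_eq_mul, mul_comm]
    · intro t ht
      rw [image_eq_zero_of_notMem_tsupport fun h' => ht (hgs h'), zero_smul]
  rw [Lp.eq_zero_iff_ae_eq_zero]
  exact (ae_restrict_iff' measurableSet_Ioo).2 key

/-- An operator whose quadratic form vanishes on test functions is zero. -/
theorem operator_eq_zero_of_inner_test {D : OuterSpace T →L[ℝ] OuterSpace T}
    (h : ∀ φ ψ : ℝ → ℝ, ∀ hφ : ContDiff ℝ ∞ φ, ∀ hφc : HasCompactSupport φ,
      ∀ hψ : ContDiff ℝ ∞ ψ, ∀ hψc : HasCompactSupport ψ, tsupport φ ⊆ Ioo 0 T →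
      tsupport ψ ⊆ Ioo 0 T →
      inner ℝ (D ((memLp_outerMeasure hφ.continuous hφc).toLp φ))
        ((memLp_outerMeasure hψ.continuous hψc).toLp ψ) = 0) : D = 0 := by
  -- Passing to the adjoint lets `eq_zero_of_inner_test` serve for both arguments: once for D φ,
  -- once for the adjoint applied to an arbitrary g.
  have h1 : ContinuousLinearMap.adjoint D = 0 := by
    ext1 g
    refine eq_zero_of_inner_test fun φ hφ hφc hφs => ?_
    rw [ContinuousLinearMap.adjoint_inner_left, eq_zero_of_inner_test (u := D _)
      fun ψ hψ hψc hψs => h φ ψ hφ hφc hψ hψc hφs hψs, inner_zero_right]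
  rw [← ContinuousLinearMap.adjoint_adjoint D, h1, map_zero]

/-- The primitive of the response function. -/
noncomputable def responsePrimitive (ρ : ℝ → ℝ) (r : ℝ → ℝ → ℝ) (t : ℝ) : ℝ :=
  ∫ η in (0 : ℝ)..t, sectorKernel ρ r 0 η

/-- The kernel of the connecting operator. -/
noncomputable def connectingKernel (ρ : ℝ → ℝ) (r : ℝ → ℝ → ℝ) (T t s : ℝ) : ℝ :=
  1 / 2 * (responsePrimitive ρ r |t - s| - responsePrimitive ρ r (2 * T - t - s))

theorem intervalIntegrable_boundary (h : IsAdmissible ρ q) (hr : IsFundamentalSolution ρ q r)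
    (a b : ℝ) : IntervalIntegrable (sectorKernel ρ r 0) volume a b :=
  (((hr.isWaveKernel h).locallyIntegrable 0).integrableOn_isCompact
    isCompact_uIcc).intervalIntegrable

theorem continuous_responsePrimitive (h : IsAdmissible ρ q) (hr : IsFundamentalSolution ρ q r) :
    Continuous (responsePrimitive ρ r) :=
  intervalIntegral.continuous_primitive (intervalIntegrable_boundary h hr) 0

theorem connectingKernel_eq (h : IsAdmissible ρ q) (hr : IsFundamentalSolution ρ q r) (t s : ℝ) :
    connectingKernel ρ r T t s
      = - (1 / 2 * ∫ η in |t - s|..(2 * T - t - s), sectorKernel ρ r 0 η) := by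
  rw [connectingKernel, responsePrimitive, responsePrimitive,
    ← intervalIntegral.integral_interval_sub_left (intervalIntegrable_boundary h hr 0
      (2 * T - t - s)) (intervalIntegrable_boundary h hr 0 |t - s|)]
  ring

/-- For t, s ≤ T one has |t − s| ≤ 2T − t − s, so only nonnegative times are integrated over, and
there the zero extension equals r. -/
theorem connectingKernel_eq_response (h : IsAdmissible ρ q) (hr : IsFundamentalSolution ρ q r)
    {t s : ℝ} (ht : t ≤ T) (hs : s ≤ T) :
    connectingKernel ρ r T t s = - (1 / 2 * ∫ η in |t - s|..(2 * T - t - s), r 0 η) := by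
  rw [connectingKernel_eq h hr]
  congr 2
  refine intervalIntegral.integral_congr fun η hη => ?_
  have hle : |t - s| ≤ 2 * T - t - s := abs_le.2 ⟨by linarith, by linarith⟩
  rw [uIcc_of_le hle] at hη
  exact sectorKernel_zero_left ((abs_nonneg _).trans hη.1)

theorem continuous_connectingKernel (h : IsAdmissible ρ q) (hr : IsFundamentalSolution ρ q r) :
    Continuous (Function.uncurry (connectingKernel ρ r T)) := by
  have := continuous_responsePrimitive h hr
  simp only [Function.uncurry_def, connectingKernel]
  fun_prop

theorem exists_connectingKernelOperator (h : IsAdmissible ρ q) (hr : IsFundamentalSolution ρ q r)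
    (T : ℝ) : ∃ K : OuterSpace T →L[ℝ] OuterSpace T, ∀ f : OuterSpace T,
      ∀ᵐ t ∂(outerMeasure T), K f t = ∫ s in Ioo 0 T, connectingKernel ρ r T t s * f s := by
  have hc := continuous_connectingKernel (T := T) h hr
  obtain ⟨M, hM⟩ := ((isCompact_Icc (a := (0 : ℝ)) (b := T)).prod
    (isCompact_Icc (a := (0 : ℝ)) (b := T))).exists_bound_of_continuousOn hc.continuousOn
  refine exists_integralOperator (μ := outerMeasure T) (ν := outerMeasure T)
    (K := connectingKernel ρ r T) hc.measurable (le_max_right M 0) ?_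
  filter_upwards [ae_outerMeasure_mem T] with t ht
  filter_upwards [ae_outerMeasure_mem T] with s hs
  exact (hM (t, s) ⟨Ioo_subset_Icc_self ht, Ioo_subset_Icc_self hs⟩).trans (le_max_left _ _)

/-- A control supported in (0,T) makes the truncation of the time integral invisible, which links
`W` to the whole-line convolution of the energy argument. -/
theorem controlOperator_test (h : IsAdmissible ρ q) {W : OuterSpace T →L[ℝ] InnerSpace ρ T}
    (hW : IsControlOperator ρ r T W) {φ : ℝ → ℝ} (hφ : Continuous φ) (hφc : HasCompactSupport φ)
    (hφs : tsupport φ ⊆ Ioo 0 T) :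
    ∀ᵐ x ∂(innerMeasure ρ T), W ((memLp_outerMeasure hφ hφc).toLp φ) x
      = conv (sectorKernel ρ r) φ x T := by
  filter_upwards [hW ((memLp_outerMeasure hφ hφc).toLp φ), ae_innerMeasure_mem ρ T] with x hx hxm
  rw [hx, wave_eq_setIntegral h r _ hxm.1.le le_rfl, conv,
    ← integral_sub_left_eq_self (fun t => sectorKernel ρ r x t * φ (T - t)) volume T]
  simp only [sub_sub_cancel]
  rw [← setIntegral_eq_integral_of_forall_compl_eq_zero (s := Ioo 0 T)
    (f := fun s => sectorKernel ρ r x (T - s) * φ s)]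
  · refine integral_congr_ae ?_
    filter_upwards [MemLp.coeFn_toLp (memLp_outerMeasure (T := T) hφ hφc)] with s hs
    rw [hs]
  · intro s hs
    rw [image_eq_zero_of_notMem_tsupport fun h' => hs (hφs h'), mul_zero]

/-- The connecting operator is an integral operator. -/
theorem connectingOperator_eq (h : IsAdmissible ρ q) (hr : IsFundamentalSolution ρ q r)
    (hT : 0 < T) {W : OuterSpace T →L[ℝ] InnerSpace ρ T} (hW : IsControlOperator ρ r T W)
    {K : OuterSpace T →L[ℝ] OuterSpace T} (hK : ∀ f : OuterSpace T,
      ∀ᵐ t ∂(outerMeasure T), K f t = ∫ s in Ioo 0 T, connectingKernel ρ r T t s * f s) :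
    connectingOperator W = K := by
  have hk := hr.isWaveKernel h
  refine sub_eq_zero.1 (operator_eq_zero_of_inner_test fun φ ψ hφ hφc hψ hψc hφs hψs => ?_)
  rw [_root_.sub_apply, inner_sub_left, sub_eq_zero]
  have e1 : inner ℝ (connectingOperator W ((memLp_outerMeasure hφ.continuous hφc).toLp φ))
      ((memLp_outerMeasure hψ.continuous hψc).toLp ψ)
      = IsWaveKernel.energy (constExtend ρ) (sectorKernel ρ r) φ ψ T T := by
    rw [connectingOperator, ContinuousLinearMap.comp_apply, ContinuousLinearMap.adjoint_inner_left,
      L2.inner_def]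
    calc _ = ∫ x, conv (sectorKernel ρ r) φ x T * conv (sectorKernel ρ r) ψ x T
          ∂(innerMeasure ρ T) := by
          refine integral_congr_ae ?_
          filter_upwards [controlOperator_test h hW hφ.continuous hφc hφs,
            controlOperator_test h hW hψ.continuous hψc hψs] with x h1 h2
          rw [h1, h2]
          simp [mul_comm]
      _ = _ := by
          rw [integral_innerMeasure h, IsWaveKernel.energy, ← integral_Ioc_eq_integral_Ioo,
            ← integral_Icc_eq_integral_Ioc]
          refine setIntegral_eq_integral_of_forall_compl_eq_zero fun x hx => ?_
          -- At time T the wave has not passed x(T), so integrating over (0, x(T)) loses nothing.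
          have : conv (sectorKernel ρ r) φ x T = 0 := by
            refine integral_eq_zero_of_ae (ae_of_all _ fun t => ?_)
            by_cases hxt : (x, t) ∈ sector ρ
            · have hTt : T < t := by
                by_contra h'
                refine hx ⟨hxt.1, (h.strictMonoOn_eikonal.le_iff_le hxt.1
                  (h.frontPoint_nonneg hT.le)).1 ?_⟩
                rw [h.eikonal_frontPoint hT.le]
                exact hxt.2.trans (not_lt.1 h')
              have : φ (T - t) = 0 := image_eq_zero_of_notMem_tsupport fun h' => by
                linarith [(hφs h').1]
              simp [this]
            · simp [sectorKernel_of_notMem hxt]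
          rw [this, zero_mul, mul_zero]
  rw [e1, hk.energy_eq hT.le hφ hφc hφs hψ hψc hψs, inner_outerSpace,
    intervalIntegral.integral_of_le hT.le, integral_Ioc_eq_integral_Ioo, ← integral_neg]
  refine integral_congr_ae ?_
  filter_upwards [hK ((memLp_outerMeasure hφ.continuous hφc).toLp φ),
    MemLp.coeFn_toLp (memLp_outerMeasure (T := T) hψ.continuous hψc), ae_outerMeasure_mem T]
    with t h1 h2 ht
  rw [h1, h2, hk.integral_oddConv hφ.continuous hφc hφs ht, ← neg_mul, ← mul_neg,
    intervalIntegral.integral_of_le hT.le, integral_Ioc_eq_integral_Ioo, ← integral_neg,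
    ← integral_const_mul]
  congr 1
  refine integral_congr_ae ?_
  filter_upwards [MemLp.coeFn_toLp (memLp_outerMeasure (T := T) hφ.continuous hφc)] with s hs
  rw [hs, connectingKernel_eq h hr]
  ring

/-! ### The factorization through the response operator. -/

theorem intervalIntegrable_outerSpace (hT : 0 ≤ T) (f : OuterSpace T) :
    IntervalIntegrable f volume 0 T := by
  rw [intervalIntegrable_iff_integrableOn_Ioo_of_le hT]
  exact (Lp.memLp f).integrable (by norm_num)

/-- Exchanging the order of integration moves the primitive from the control to the kernel. -/
theorem response_integration_eq (h : IsAdmissible ρ q) (hr : IsFundamentalSolution ρ q r)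
    {R J : OuterSpace (2 * T) →L[ℝ] OuterSpace (2 * T)} (hR : IsExtendedResponseOperator ρ r T R)
    (hJ : IsIntegrationOperator T J) (F : OuterSpace (2 * T)) :
    ∀ᵐ t ∂(outerMeasure (2 * T)),
      R (J F) t = ∫ σ in (0 : ℝ)..t, responsePrimitive ρ r (t - σ) * F σ := by
  filter_upwards [hR (J F), ae_outerMeasure_mem (2 * T)] with t ht htm
  have hF : IntegrableOn F (Ioc 0 t) := by
    have := intervalIntegrable_outerSpace (htm.1.trans htm.2).le F
    rw [intervalIntegrable_iff_integrableOn_Ioc_of_le (htm.1.trans htm.2).le] at this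
    exact this.mono_set (Ioc_subset_Ioc_right htm.2.le)
  have hk : IntegrableOn (fun s => sectorKernel ρ r 0 (t - s)) (Ioc 0 t) := by
    have := (intervalIntegrable_boundary h hr t 0).comp_sub_left t
    rwa [sub_self, sub_zero, intervalIntegrable_iff_integrableOn_Ioc_of_le htm.1.le] at this
  have hprod : IntegrableOn (Function.uncurry fun s σ => sectorKernel ρ r 0 (t - s) * F σ)
      (Ioc 0 t ×ˢ Ioc 0 t) := by
    rw [IntegrableOn, Measure.volume_eq_prod, ← Measure.prod_restrict]
    exact Integrable.mul_prod hk hF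
  rw [ht, wave_eq_setIntegral h r _ le_rfl le_rfl]
  calc _ = ∫ s in Ioo 0 t, ∫ σ in (0 : ℝ)..s, sectorKernel ρ r 0 (t - s) * F σ := by
        refine integral_congr_ae ?_
        filter_upwards [ae_restrict_of_ae_restrict_of_subset
          (Ioo_subset_Ioo_right htm.2.le) (hJ F)] with s hs
        rw [hs, intervalIntegral.integral_const_mul]
    _ = ∫ σ in (0 : ℝ)..t, ∫ s in σ..t, sectorKernel ρ r 0 (t - s) * F σ := by
        rw [← integral_integral_triangle htm.1.le hprod, intervalIntegral.integral_of_le htm.1.le,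
          integral_Ioc_eq_integral_Ioo]
    _ = _ := by
        refine intervalIntegral.integral_congr fun σ _ => ?_
        rw [intervalIntegral.integral_mul_const,
          intervalIntegral.integral_comp_sub_left (fun s => sectorKernel ρ r 0 s), sub_self,
          responsePrimitive]

theorem intervalIntegral_congr_ae_Ioo {a b c : ℝ} {u v : ℝ → ℝ} (ha : 0 ≤ a) (hab : a ≤ b)
    (hbc : b ≤ c) (h : ∀ᵐ s ∂(outerMeasure c), u s = v s) :
    ∫ s in a..b, u s = ∫ s in a..b, v s := by
  rw [intervalIntegral.integral_of_le hab, intervalIntegral.integral_of_le hab,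
    integral_Ioc_eq_integral_Ioo, integral_Ioc_eq_integral_Ioo]
  exact integral_congr_ae
    (ae_restrict_of_ae_restrict_of_subset (Ioo_subset_Ioo ha hbc) h)

/-- The odd part, with respect to `T`, of the response to the primitive of an odd control. -/
theorem response_integration_odd (h : IsAdmissible ρ q) (hr : IsFundamentalSolution ρ q r)
    (hT : 0 < T) {R J : OuterSpace (2 * T) →L[ℝ] OuterSpace (2 * T)}
    {S : OuterSpace T →L[ℝ] OuterSpace (2 * T)} (hR : IsExtendedResponseOperator ρ r T R)
    (hJ : IsIntegrationOperator T J) (hS : IsOddExtensionOperator T S) (f : OuterSpace T) :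
    ∀ᵐ t ∂(outerMeasure T), R (J (S f)) t - R (J (S f)) (2 * T - t)
      = 2 * ∫ s in Ioo 0 T, connectingKernel ρ r T t s * f s := by
  have hP := continuous_responsePrimitive h hr
  set P := responsePrimitive ρ r with hPdef
  have hS1 : ∀ᵐ s ∂(outerMeasure T), S f s = f s ∧ S f (2 * T - s) = - f s := by
    filter_upwards [ae_outerMeasure_two_mul hT (hS f), ae_outerMeasure_mem T] with s hs hsm
    refine ⟨by rw [hs.1, if_pos hsm.2.le], ?_⟩
    rw [hs.2, if_neg (by linarith [hsm.2]), sub_sub_cancel]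
  filter_upwards [ae_outerMeasure_two_mul hT (response_integration_eq h hr hR hJ (S f)),
    ae_outerMeasure_mem T] with t ht htm
  have hfi : ∀ a b : ℝ, 0 ≤ a → a ≤ b → b ≤ T → ∀ Q : ℝ → ℝ, Continuous Q →
      IntervalIntegrable (fun s => Q s * f s) volume a b := by
    intro a b ha hab hb Q hQ
    refine ((intervalIntegrable_outerSpace hT.le f).mono_set ?_).continuousOn_mul hQ.continuousOn
    rw [uIcc_of_le hab, uIcc_of_le hT.le]
    exact Icc_subset_Icc ha hb
  have hFi : ∀ a b : ℝ, 0 ≤ a → a ≤ b → b ≤ 2 * T → ∀ Q : ℝ → ℝ, Continuous Q →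
      IntervalIntegrable (fun s => Q s * S f s) volume a b := by
    intro a b ha hab hb Q hQ
    have hT2 : 0 ≤ 2 * T := by linarith
    refine ((intervalIntegrable_outerSpace hT2 (S f)).mono_set ?_).continuousOn_mul
      hQ.continuousOn
    rw [uIcc_of_le hab, uIcc_of_le hT2]
    exact Icc_subset_Icc ha hb
  have e1 : R (J (S f)) t = ∫ s in (0 : ℝ)..t, P (t - s) * f s := by
    rw [ht.1]
    refine intervalIntegral_congr_ae_Ioo le_rfl htm.1.le htm.2.le ?_
    filter_upwards [hS1] with s hs
    rw [hs.1]
  have e2 : R (J (S f)) (2 * T - t) = (∫ s in (0 : ℝ)..T, P (2 * T - t - s) * f s)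
      + -∫ s in t..T, P (s - t) * f s := by
    rw [ht.2, ← intervalIntegral.integral_add_adjacent_intervals
      (hFi 0 T le_rfl hT.le (by linarith) (fun s => P (2 * T - t - s)) (by fun_prop))
      (hFi T (2 * T - t) hT.le (by linarith [htm.2]) (by linarith [htm.1])
        (fun s => P (2 * T - t - s)) (by fun_prop))]
    congr 1
    · refine intervalIntegral_congr_ae_Ioo le_rfl hT.le le_rfl ?_
      filter_upwards [hS1] with s hs
      rw [hs.1]
    -- On (T, 2T − t) the substitution s ↦ 2T − s returns to (t, T), and the odd extension supplies
    -- the minus sign.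
    · have e := intervalIntegral.integral_comp_sub_left
        (fun s => P (2 * T - t - s) * S f s) (a := t) (b := T) (2 * T)
      have eT : 2 * T - T = T := by ring
      rw [eT] at e
      rw [← e, ← intervalIntegral.integral_neg]
      refine intervalIntegral_congr_ae_Ioo htm.1.le htm.2.le le_rfl ?_
      filter_upwards [hS1] with s hs
      have es : 2 * T - t - (2 * T - s) = s - t := by ring
      rw [hs.2, es, mul_neg]
  have e3 : 2 * ∫ s in Ioo 0 T, connectingKernel ρ r T t s * f s
      = (∫ s in (0 : ℝ)..T, P |t - s| * f s) - ∫ s in (0 : ℝ)..T, P (2 * T - t - s) * f s := by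
    rw [← intervalIntegral.integral_sub
      (hfi 0 T le_rfl hT.le le_rfl (fun s => P |t - s|) (by fun_prop))
      (hfi 0 T le_rfl hT.le le_rfl (fun s => P (2 * T - t - s)) (by fun_prop)),
      intervalIntegral.integral_of_le hT.le, integral_Ioc_eq_integral_Ioo, ← integral_const_mul]
    refine integral_congr_ae (ae_of_all _ fun s => ?_)
    simp only [connectingKernel]
    ring
  have e4 : ∫ s in (0 : ℝ)..T, P |t - s| * f s
      = (∫ s in (0 : ℝ)..t, P (t - s) * f s) + ∫ s in t..T, P (s - t) * f s := by
    rw [← intervalIntegral.integral_add_adjacent_intervals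
      (hfi 0 t le_rfl htm.1.le htm.2.le (fun s => P |t - s|) (by fun_prop))
      (hfi t T htm.1.le htm.2.le le_rfl (fun s => P |t - s|) (by fun_prop))]
    congr 1
    · refine intervalIntegral.integral_congr fun s hs => ?_
      rw [uIcc_of_le htm.1.le] at hs
      simp only [abs_of_nonneg (sub_nonneg.2 hs.2)]
    · refine intervalIntegral.integral_congr fun s hs => ?_
      rw [uIcc_of_le htm.2.le] at hs
      simp only [abs_of_nonpos (sub_nonpos.2 hs.1), neg_sub]
  rw [e1, e2, e3, e4]
  ring

/-- This computes S^*: the half over (T, 2T) is folded back by t ↦ 2T − t. -/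
theorem inner_oddExtension (hT : 0 < T) {S : OuterSpace T →L[ℝ] OuterSpace (2 * T)}
    (hS : IsOddExtensionOperator T S) (u : OuterSpace (2 * T)) (g : OuterSpace T) :
    inner ℝ u (S g) = ∫ t in Ioo 0 T, (u t - u (2 * T - t)) * g t := by
  have hT2 : 0 ≤ 2 * T := by linarith
  have hi : IntervalIntegrable (fun t => u t * S g t) volume 0 (2 * T) := by
    rw [intervalIntegrable_iff_integrableOn_Ioo_of_le hT2]
    exact (Lp.memLp u).integrable_mul (Lp.memLp (S g))
  have i1 : IntervalIntegrable (fun t => u t * S g t) volume 0 T := by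
    refine hi.mono_set ?_
    rw [uIcc_of_le hT2, uIcc_of_le hT.le]
    exact Icc_subset_Icc_right (by linarith)
  have i2 : IntervalIntegrable (fun t => u t * S g t) volume T (2 * T) := by
    refine hi.mono_set ?_
    rw [uIcc_of_le hT2, uIcc_of_le (by linarith)]
    exact Icc_subset_Icc_left hT.le
  have i3 := (i2.comp_sub_left (2 * T)).symm
  have eT : 2 * T - T = T := by ring
  rw [sub_self, eT] at i3
  have e := intervalIntegral.integral_comp_sub_left
    (fun t => u t * S g t) (a := 0) (b := T) (2 * T)
  rw [eT, sub_zero] at e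
  rw [inner_outerSpace, ← integral_Ioc_eq_integral_Ioo, ← intervalIntegral.integral_of_le hT2,
    ← intervalIntegral.integral_add_adjacent_intervals i1 i2, ← e,
    ← intervalIntegral.integral_add i1 i3, intervalIntegral.integral_of_le hT.le,
    integral_Ioc_eq_integral_Ioo]
  refine integral_congr_ae ?_
  filter_upwards [ae_outerMeasure_two_mul hT (hS g), ae_outerMeasure_mem T] with t ht htm
  rw [ht.1, ht.2, if_pos htm.2.le, if_neg (by linarith [htm.2]), sub_sub_cancel]
  ring

end NeumannWave

theorem theorem3 (ρ q : ℝ → ℝ) (hρq : IsAdmissible ρ q)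
    (r : ℝ → ℝ → ℝ) (hr : IsFundamentalSolution ρ q r) (T : ℝ) (hT : 0 < T) :
    ∃ (W : OuterSpace T →L[ℝ] InnerSpace ρ T)
      (R J : OuterSpace (2 * T) →L[ℝ] OuterSpace (2 * T))
      (S : OuterSpace T →L[ℝ] OuterSpace (2 * T)),
      IsControlOperator ρ r T W ∧ IsExtendedResponseOperator ρ r T R ∧
      IsIntegrationOperator T J ∧ IsOddExtensionOperator T S ∧
      connectingOperator W
        = (1 / 2 : ℝ) • ((ContinuousLinearMap.adjoint S) ∘L R ∘L J ∘L S) ∧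
      ∀ f : OuterSpace T, ∀ᵐ t ∂(outerMeasure T),
        connectingOperator W f t
          = - ∫ s in (0 : ℝ)..T,
              (1 / 2 * ∫ η in |t - s|..(2 * T - t - s), r 0 η) * f s := by
  obtain ⟨W, hW⟩ := exists_controlOperator hρq hr T
  obtain ⟨R, hR⟩ := exists_extendedResponseOperator hρq hr T
  obtain ⟨J, hJ⟩ := exists_integrationOperator T
  obtain ⟨S, hS⟩ := exists_oddExtensionOperator hT
  obtain ⟨K, hK⟩ := exists_connectingKernelOperator hρq hr T
  have hCK := connectingOperator_eq hρq hr hT hW hK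
  refine ⟨W, R, J, S, hW, hR, hJ, hS, ?_, fun f => ?_⟩
  -- With C^T replaced by its integral operator, both sides are paired with an arbitrary g; S^* then
  -- forms the odd part of R J S f about T, which is twice the kernel integral.
  · rw [hCK]
    refine ContinuousLinearMap.ext fun f => ext_inner_right ℝ fun g => ?_
    rw [_root_.smul_apply, real_inner_smul_left, ContinuousLinearMap.comp_apply,
      ContinuousLinearMap.adjoint_inner_left, inner_oddExtension hT hS, inner_outerSpace,
      ← integral_const_mul]
    refine integral_congr_ae ?_
    filter_upwards [hK f, response_integration_odd hρq hr hT hR hJ hS f] with t h1 h2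
    simp only [ContinuousLinearMap.comp_apply]
    rw [h1, h2]
    ring
  · rw [hCK]
    filter_upwards [hK f, ae_outerMeasure_mem T] with t h1 ht
    rw [h1, intervalIntegral.integral_of_le hT.le, integral_Ioc_eq_integral_Ioo, ← integral_neg]
    refine setIntegral_congr_fun measurableSet_Ioo fun s hs => ?_
    rw [connectingKernel_eq_response hρq hr ht.2.le hs.2.le, neg_mul]
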